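/- Let $K$ be a commutative $\mathbb{Q}$-algebra (for instance $K=\mathbb{R}$), let $s\in K$, let $c_{i,k}\in K$ for $i\ge 0$, $k\ge 1$, and put $F_k(\rho)=\sum_{i\ge 0}c_{i,k}\rho^{i-1}$. Consider the Dyson--Schwinger equation $$G(x,L)=1+\sum_{k\ge 1}x^k\,G\!\left(x,\tfrac{\partial}{\partial\rho}\right)^{1+sk}(e^{L\rho}-1)F_k(\rho)\Big|_{\rho=0}\qquad(\ast)$$ for a formal power series $G(x,L)\in K[L][[x]]$. Here $G^{p}=\sum_{r\ge 0}\binom{p}{r}(G-1)^r$ for $p\in K$ (any solution $G$ satisfies $G\equiv 1 \bmod x$), and for each power of $x$ the coefficient polynomial in $L$ is evaluated at $L=\partial/\partial\rho$. A weighted rooted tree $t$ is a finite rooted tree with root $\operatorname{rt}(t)$ and a weight $w(v)\in\mathbb{Z}_{\ge 1}$ at each vertex $v\in V(t)$; its weight is $w(t)=\sum_{v}w(v)$. Write $\operatorname{od} v$ for the number of children of $v$, and $\operatorname{Aut}(t)$ for the group of graph automorphisms of $t$ that preserve the root and the weights. A tube is a set of vertices that induces a connected (nonempty) subgraph; its root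 is its vertex closest to $\operatorname{rt}(t)$. A (binary) tubing $\tau$ of $t$ is a set of tubes, any two of which are disjoint or nested, which contains the tube $V(t)$ and in which every tube is either a single vertex or is partitioned by two other tubes of $\tau$. Let $\mathrm{Tub}(t)$ be the set of tubings of $t$. For $\tau\in\mathrm{Tub}(t)$ let $b(v,\tau)$ be the number of tubes of $\tau$ with root $v$, let $b(\tau)=b(\operatorname{rt}(t),\tau)$, and let $c(\tau)=\prod_{v\ne\operatorname{rt}(t)}c_{b(v,\tau)-1,\,w(v)}$. Let $(y)_m=y(y-1)\cdots(y-m+1)$ be the falling factorial. Theorem. Define $$\phi_L(\tau)=c(\tau)\sum_{i=1}^{b(\tau)}c_{b(\tau)-i,\,w(\operatorname{rt}(t))}\frac{L^i}{i!}.$$ Then the Dyson--Schwinger equation $(\ast)$ has exactly one solution in $K[L][[x]]$, namely $$G(x,L)=1+\sum_{t}\frac{x^{w(t)}}{|\operatorname{Aut}(t)|}\left(\prod_{v\in V(t)}(1+s\,w(v))_{\operatorname{od} v}\right)\sum_{\tau\in\mathrm{Tub}(t)}\phi_L(\tau),$$ where the outer sum is over all isomorphism classes of weighted rooted trees. In particular,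 the anomalous dimension is $$\gamma(x)=[L^1]G(x,L)=\sum_{t}\frac{x^{w(t)}}{|\operatorname{Aut}(t)|}\left(\prod_{v\in V(t)}(1+s\,w(v))_{\operatorname{od} v}\right)\sum_{\tau\in\mathrm{Tub}(t)}\ \prod_{v\in V(t)}c_{b(v,\tau)-1,\,w(v)}.$$ -/

import Mathlib

namespace TubingDSE

/-! Weighted rooted trees -/

/-- A rooted tree with vertex set `V` whose vertices carry weights in `ℤ_{≥ 1}`.
The tree is given by its root and its parent map; the root is, by convention, its own parent,
and every vertex is connected to the root by the chain of its ancestors. -/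
structure WRTree (V : Type*) where
  root : V
  parent : V → V
  parent_root : parent root = root
  reaches_root : ∀ v, ∃ n : ℕ, parent^[n] v = root
  weight : V → ℕ+

namespace WRTree

variable {V : Type*} {V' : Type*}

/-- The underlying graph: edges join each non-root vertex to its parent. -/
def graph (t : WRTree V) : SimpleGraph V :=
  SimpleGraph.fromRel fun u v => t.parent u = v

/-- Isomorphisms of weighted rooted trees: graph isomorphisms that preserve the root and
the weights. -/
def Iso (t : WRTree V) (t' : WRTree V') : Type _ :=
  {e : t.graph ≃g t'.graph // e t.root = t'.root ∧ ∀ v, t'.weight (e v) = t.weight v}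

/-- Automorphisms of a weighted rooted tree. -/
abbrev Aut (t : WRTree V) : Type _ := Iso t t

/-- The weight `w(t)` of a tree: the sum of the weights of its vertices. -/
def totalWeight [Fintype V] (t : WRTree V) : ℕ := ∑ v, (t.weight v : ℕ)

/-- The number of children `od v` of a vertex `v`. -/
def outDegree [Fintype V] [DecidableEq V] (t : WRTree V) (v : V) : ℕ :=
  (Finset.univ.filter fun u => u ≠ t.root ∧ t.parent u = v).card

/-! Tubings -/

/-- A tube: a set of vertices that induces a connected (in particular nonempty) subgraph. -/
def IsTube (t : WRTree V) (b : Finset V) : Prop :=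
  (t.graph.induce (b : Set V)).Connected

/-- A binary tubing: a nested family of tubes that contains the tube of all vertices and in which
each tube is a single vertex or is partitioned by two other tubes of the family. -/
structure IsTubing [Fintype V] [DecidableEq V] (t : WRTree V) (τ : Finset (Finset V)) : Prop where
  isTube : ∀ b ∈ τ, t.IsTube b
  univ_mem : Finset.univ ∈ τ
  split : ∀ b ∈ τ, b.card = 1 ∨
    ∃ b₁ ∈ τ, ∃ b₂ ∈ τ, b₁ ≠ b ∧ b₂ ≠ b ∧ Disjoint b₁ b₂ ∧ b₁ ∪ b₂ = b
  nested : ∀ b ∈ τ, ∀ b' ∈ τ, Disjoint b b' ∨ b ⊆ b' ∨ b' ⊆ b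

open Classical in
/-- The finite set `Tub(t)` of all tubings of `t`. -/
noncomputable def tubings [Fintype V] [DecidableEq V] (t : WRTree V) :
    Finset (Finset (Finset V)) :=
  Finset.univ.filter fun τ => t.IsTubing τ

/-- `v` is the root of the tube `b`, i.e. the vertex of `b` that is closest to the root of `t`. -/
def IsRootOf (t : WRTree V) (v : V) (b : Finset V) : Prop :=
  v ∈ b ∧ (v = t.root ∨ t.parent v ∉ b)

open Classical in
/-- The `b`-statistic `b(v, τ)`: the number of tubes of `τ` whose root is `v`. -/
noncomputable def bStat (t : WRTree V) (τ : Finset (Finset V)) (v : V) : ℕ :=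
  (τ.filter fun b => t.IsRootOf v b).card

variable {K : Type*} [CommRing K]

/-- The Mellin monomial `c(τ)`, a product over the non-root vertices. -/
noncomputable def mellinMonomial [Fintype V] [DecidableEq V] (c : ℕ → ℕ → K) (t : WRTree V)
    (τ : Finset (Finset V)) : K :=
  ∏ v ∈ Finset.univ.erase t.root, c (t.bStat τ v - 1) (t.weight v)

/-- The contribution `φ_L(τ)` of a tubing `τ` of `t`, a polynomial in `L`. -/
noncomputable def phi [Algebra ℚ K] [Fintype V] [DecidableEq V] (c : ℕ → ℕ → K) (t : WRTree V)
    (τ : Finset (Finset V)) : Polynomial K :=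
  Polynomial.C (t.mellinMonomial c τ) *
    ∑ i ∈ Finset.Icc 1 (t.bStat τ t.root),
      Polynomial.C (c (t.bStat τ t.root - i) (t.weight t.root)) *
        ((i.factorial : ℚ)⁻¹ • (Polynomial.X : Polynomial K) ^ i)

/-- The factor `|Aut t|⁻¹ ∏_v (1 + s w(v))_{od v}`, where `(x)_k` is the falling factorial. -/
noncomputable def treeFactor [Algebra ℚ K] [Fintype V] [DecidableEq V] (s : K) (t : WRTree V) :
    K :=
  (Nat.card t.Aut : ℚ)⁻¹ •
    ∏ v, (descPochhammer K (t.outDegree v)).eval (1 + s * ((t.weight v : ℕ) : K))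

end WRTree

/-! Isomorphism classes of weighted rooted trees -/

/-- Weighted rooted trees of weight `n`, with vertex set `{0, …, m - 1}` for some `m`. -/
def TreeOfWeight (n : ℕ) : Type :=
  {t : Σ m : ℕ, WRTree (Fin m) // t.2.totalWeight = n}

namespace TreeOfWeight

variable {n : ℕ}

/-- The number of vertices. -/
def size (t : TreeOfWeight n) : ℕ := t.1.1

/-- The underlying weighted rooted tree. -/
def tree (t : TreeOfWeight n) : WRTree (Fin t.size) := t.1.2

/-- Being isomorphic, as an equivalence relation on the trees of weight `n`. -/
def isoSetoid (n : ℕ) : Setoid (TreeOfWeight n) where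
  r t t' := Nonempty (WRTree.Iso t.tree t'.tree)
  iseqv :=
    { refl := fun _ => ⟨⟨RelIso.refl _, rfl, fun _ => rfl⟩⟩
      symm := by
        rintro t t' ⟨⟨e, h1, h2⟩⟩
        refine ⟨⟨e.symm, ?_, fun v => ?_⟩⟩
        · rw [← h1]; exact e.symm_apply_apply _
        · rw [← h2 (e.symm v)]; congr 1; exact e.apply_symm_apply v
      trans := by
        rintro t t' t'' ⟨⟨e, h1, h2⟩⟩ ⟨⟨f, k1, k2⟩⟩
        refine ⟨⟨e.trans f, ?_, fun v => ?_⟩⟩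
        · rw [← k1, ← h1]; rfl
        · rw [← h2 v, ← k2 (e v)]; rfl }

instance instFinite (n : ℕ) : Finite (TreeOfWeight n) := by
  have hw : ∀ (t : TreeOfWeight n) (v : Fin t.size), (t.tree.weight v : ℕ) ≤ n := by
    intro t v
    have h : t.tree.totalWeight = n := t.2
    exact (Finset.single_le_sum (f := fun v => (t.tree.weight v : ℕ))
      (fun _ _ => Nat.zero_le _) (Finset.mem_univ v)).trans h.le
  have hs : ∀ t : TreeOfWeight n, t.size ≤ n := by
    intro t
    have h : t.tree.totalWeight = n := t.2
    calc t.size = ∑ _v : Fin t.size, 1 := by simp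
      _ ≤ ∑ v, (t.tree.weight v : ℕ) := Finset.sum_le_sum fun v _ => (t.tree.weight v).pos
      _ = n := h
  let f : TreeOfWeight n →
      (Σ m : Fin (n + 1), Fin m × (Fin m → Fin m) × (Fin m → Fin (n + 1))) := fun t =>
    ⟨⟨t.size, Nat.lt_succ_of_le (hs t)⟩, t.tree.root, t.tree.parent,
      fun v => ⟨t.tree.weight v, Nat.lt_succ_of_le (hw t v)⟩⟩
  refine Finite.of_injective f ?_
  rintro ⟨⟨m, t⟩, ht⟩ ⟨⟨m', t'⟩, ht'⟩ h
  have hm : m = m' := congrArg (fun z => (z.1 : ℕ)) h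
  subst hm
  have h2 := eq_of_heq (Sigma.mk.inj h).2
  obtain ⟨r, p, a, b, w⟩ := t
  obtain ⟨r', p', a', b', w'⟩ := t'
  have e1 : r = r' := congrArg Prod.fst h2
  have e2 : p = p' := congrArg (fun z => z.2.1) h2
  have e3 : w = w' := by
    funext v
    have := congrArg (fun z => ((z.2.2 v : Fin (n + 1)) : ℕ)) h2
    exact PNat.coe_injective this
  subst e1 e2 e3
  rfl

end TreeOfWeight

/-- Weighted rooted trees of weight `n` up to isomorphism. -/
def TreeClass (n : ℕ) : Type := Quotient (TreeOfWeight.isoSetoid n)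

namespace TreeClass

variable {n : ℕ}

instance instFinite (n : ℕ) : Finite (TreeClass n) :=
  Quotient.finite (TreeOfWeight.isoSetoid n)

noncomputable instance instFintype (n : ℕ) : Fintype (TreeClass n) := Fintype.ofFinite _

/-- A representative of an isomorphism class. -/
noncomputable def rep (T : TreeClass n) : TreeOfWeight n :=
  Quotient.out (s := TreeOfWeight.isoSetoid n) T

/-- The tree of a representative. -/
noncomputable def tree (T : TreeClass n) : WRTree (Fin T.rep.size) := T.rep.tree

end TreeClass

/-! The Dyson--Schwinger equation -/

section DSE

variable {K : Type*} [CommRing K] [Algebra ℚ K]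

/-- The power `G ^ p = ∑_r binom(p, r) (G - 1) ^ r` with exponent `p ∈ K` of a power series
`G(x) ∈ K[L]⟦x⟧` with constant coefficient `1`; since `(G - 1) ^ r` is divisible by `x ^ r`, only
the terms with `r ≤ n` contribute to the coefficient of `x ^ n`. -/
noncomputable def seriesPow (G : PowerSeries (Polynomial K)) (p : K) :
    PowerSeries (Polynomial K) :=
  PowerSeries.mk fun n => ∑ r ∈ Finset.range (n + 1),
    ((r.factorial : ℚ)⁻¹ • (descPochhammer K r).eval p) • PowerSeries.coeff n ((G - 1) ^ r)

/-- The Laurent series `F(ρ) = ∑_{i ≥ 0} a_i ρ ^ (i - 1)`, with coefficients viewed in `K[L]`. -/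
noncomputable def mellinSeries (a : ℕ → K) : LaurentSeries (Polynomial K) :=
  HahnSeries.single (-1 : ℤ) 1 *
    ((PowerSeries.mk fun i => Polynomial.C (a i) : PowerSeries (Polynomial K)) :
      LaurentSeries (Polynomial K))

/-- The series `e ^ (L ρ) - 1` in `ρ`, with coefficients in `K[L]`. -/
noncomputable def expSubOne (K : Type*) [CommRing K] [Algebra ℚ K] :
    LaurentSeries (Polynomial K) :=
  ((PowerSeries.rescale (Polynomial.X : Polynomial K) (PowerSeries.exp (Polynomial K)) - 1 :
      PowerSeries (Polynomial K)) : LaurentSeries (Polynomial K))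

/-- The value `p(∂/∂ρ) (e ^ (L ρ) - 1) F(ρ) |_{ρ = 0}` for `p ∈ K[L]` and
`F(ρ) = ∑_{i ≥ 0} a_i ρ ^ (i - 1)`. The series `(e ^ (L ρ) - 1) F(ρ)` has no polar part, so its
derivatives can be evaluated at `ρ = 0` by taking the constant coefficient. -/
noncomputable def insertion (a : ℕ → K) (p : Polynomial K) : Polynomial K :=
  HahnSeries.coeff
    (Polynomial.aeval
      (LaurentSeries.derivative K : Module.End K (LaurentSeries (Polynomial K))) p
      (expSubOne K * mellinSeries a)) 0

/-- The series `H(x, ∂/∂ρ) (e ^ (L ρ) - 1) F(ρ) |_{ρ = 0}`, formed coefficientwise in `x`. -/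
noncomputable def insertionSeries (a : ℕ → K) (H : PowerSeries (Polynomial K)) :
    PowerSeries (Polynomial K) :=
  PowerSeries.mk fun n => insertion a (PowerSeries.coeff n H)

/-- The Dyson--Schwinger equation
`G(x, L) = 1 + ∑_{k ≥ 1} x ^ k G(x, ∂/∂ρ) ^ (1 + s k) (e ^ (L ρ) - 1) F_k(ρ) |_{ρ = 0}` with
`F_k(ρ) = ∑_{i ≥ 0} c_{i,k} ρ ^ (i - 1)`, for `G(x, L) ∈ K[L]⟦x⟧`, as an equality of all
coefficients in `x`; the summands with `k > n` do not contribute to the coefficient of `x ^ n`. -/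
def SolvesDSE (s : K) (c : ℕ → ℕ → K) (G : PowerSeries (Polynomial K)) : Prop :=
  ∀ n : ℕ, PowerSeries.coeff n G =
    PowerSeries.coeff n (1 : PowerSeries (Polynomial K)) +
      ∑ k ∈ Finset.Icc 1 n, PowerSeries.coeff n
        (PowerSeries.X ^ k * insertionSeries (fun i => c i k) (seriesPow G (1 + s * (k : K))))

/-- The coefficient `[L ^ 1] G(x, L)`, a power series in `x`. -/
noncomputable def anomalousDimension (G : PowerSeries (Polynomial K)) : PowerSeries K :=
  PowerSeries.mk fun n => (PowerSeries.coeff n G).coeff 1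

end DSE

end TubingDSE

namespace TubingDSE

/-! ### Rooted trees: depth, descendants and children -/

namespace WRTree

variable {V : Type*}

/-! Because of the factor x^k with k ≥ 1, the coefficient of x^n in (∗) involves only earlier
coefficients of G, so there is at most one solution. Let Λ_k be the linear operator f ↦
f(∂/∂ρ)(e^{Lρ} - 1)F_k(ρ)|_{ρ=0} on K[L]. Expanding the powers of G by the binomial series solves
the recursion by a sum over plane trees: a vertex of weight k with r children contributes
binom(1+sk, r), and the polynomial of a tree is Λ_k, for k the weight of the root, applied to the
product of the polynomials of its branches (`solvesDSE_planeSeries`). A tree t has ∏_v (od v)!/|Aut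
t| plane embeddings (`card_plane_mul_card_aut`), which turns this into the sum over isomorphism
classes (`sum_treeClass`).

It remains to identify the recursively defined polynomial with the sum of φ_L over tubings. Since
Λ_k(L^n/n!) = ∑_{i=1}^{n+1} c_{n+1-i,k} L^i/i!, each φ_L(τ) is Λ applied to c(τ) L^{b-1}/(b-1)!. So
the claim is that T = ∑_τ c(τ) L^{b-1}/(b-1)! is the product of ΛT_i over the branches i
(`tubePoly_eq_prod`).

For this, constant terms and derivatives are compared. A tubing of at least two vertices is the same
as an edge to cut and tubings of the two pieces (`sum_tubingsOn`), and the root gains one tube.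
Hence T' is the sum over cuts of the Mellin sum of the lower piece times the T of the upper piece.
On the other side, (Λf)' = [L^1]Λf + Λ(f') (`derivative_insertionHom`). In the Leibniz rule the
first term accounts for the cut just above a child of the root, the second for the cuts inside that
child's branch. Induction on the number of vertices finishes the argument. -/

theorem parent_induction (t : WRTree V) {p : V → Prop} (h0 : p t.root)
    (h1 : ∀ v, v ≠ t.root → p (t.parent v) → p v) (v : V) : p v := by
  obtain ⟨n, hn⟩ := t.reaches_root v
  induction n generalizing v with
  | zero => exact (show v = t.root from hn) ▸ h0
  | succ n ih =>
    by_cases hv : v = t.root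
    · exact hv ▸ h0
    · exact h1 v hv (ih _ hn)

/-- The distance of a vertex from the root. -/
noncomputable def depth (t : WRTree V) (v : V) : ℕ := sInf {n | t.parent^[n] v = t.root}

theorem depth_of_ne_root (t : WRTree V) {v : V} (hv : v ≠ t.root) :
    t.depth v = t.depth (t.parent v) + 1 := by
  have h1 : t.parent^[t.depth v] v = t.root := Nat.sInf_mem (t.reaches_root v)
  have h2 : t.parent^[t.depth (t.parent v)] (t.parent v) = t.root :=
    Nat.sInf_mem (t.reaches_root (t.parent v))
  apply le_antisymm
  · exact Nat.sInf_le h2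
  · rcases hn : t.depth v with _ | m
    · rw [hn] at h1
      exact absurd h1 hv
    · rw [hn] at h1
      have : t.depth (t.parent v) ≤ m := Nat.sInf_le h1
      omega

theorem depth_parent_le (t : WRTree V) (v : V) : t.depth (t.parent v) ≤ t.depth v := by
  by_cases hv : v = t.root
  · rw [hv, t.parent_root]
  · rw [t.depth_of_ne_root hv]; omega

/-- `w` is a child of `v`. -/
def IsChild (t : WRTree V) (w v : V) : Prop := w ≠ t.root ∧ t.parent w = v

theorem IsChild.depth {t : WRTree V} {w v : V} (h : t.IsChild w v) :
    t.depth w = t.depth v + 1 := by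
  rw [t.depth_of_ne_root h.1, h.2]

/-- `u` is a descendant of `v`. -/
def Desc (t : WRTree V) (u v : V) : Prop := ∃ n : ℕ, t.parent^[n] u = v

theorem Desc.refl (t : WRTree V) (u : V) : t.Desc u u := ⟨0, rfl⟩

theorem Desc.trans {t : WRTree V} {u v w : V} (h : t.Desc u v) (h' : t.Desc v w) :
    t.Desc u w := by
  obtain ⟨n, rfl⟩ := h
  obtain ⟨m, rfl⟩ := h'
  exact ⟨m + n, Function.iterate_add_apply _ _ _ _⟩

theorem desc_root (t : WRTree V) (u : V) : t.Desc u t.root := t.reaches_root u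

theorem desc_parent (t : WRTree V) (u : V) : t.Desc u (t.parent u) := ⟨1, rfl⟩

theorem IsChild.desc {t : WRTree V} {w v : V} (h : t.IsChild w v) : t.Desc w v :=
  h.2 ▸ t.desc_parent w

theorem Desc.eq_or_parent {t : WRTree V} {u v : V} (h : t.Desc u v) :
    u = v ∨ (u ≠ t.root ∧ t.Desc (t.parent u) v) := by
  obtain ⟨n, hn⟩ := h
  by_cases hu : u = t.root
  · left
    rw [hu, Function.iterate_fixed t.parent_root] at hn
    rw [hu, hn]
  · rcases n with _ | n
    · exact Or.inl hn
    · exact Or.inr ⟨hu, n, hn⟩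

theorem Desc.induction {t : WRTree V} {v : V} {p : V → Prop} (h0 : p v)
    (h1 : ∀ u, u ≠ v → u ≠ t.root → t.Desc (t.parent u) v → p (t.parent u) → p u) {u : V}
    (h : t.Desc u v) : p u := by
  obtain ⟨n, hn⟩ := h
  induction n generalizing u with
  | zero => exact (show u = v from hn) ▸ h0
  | succ n ih =>
    by_cases huv : u = v
    · exact huv ▸ h0
    · rcases Desc.eq_or_parent (t := t) ⟨n + 1, hn⟩ with h | h
      · exact absurd h huv
      · exact h1 u huv h.1 h.2 (ih hn)

theorem Desc.depth_lt {t : WRTree V} {u v : V} (h : t.Desc u v) (hne : u ≠ v) :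
    t.depth v < t.depth u := by
  revert hne
  refine Desc.induction (p := fun u => u ≠ v → t.depth v < t.depth u)
    (fun h => absurd rfl h) ?_ h
  intro u _ hur _ ih _
  rw [t.depth_of_ne_root hur]
  by_cases h : t.parent u = v
  · rw [h]; omega
  · have := ih h; omega

theorem Desc.antisymm {t : WRTree V} {u v : V} (h : t.Desc u v) (h' : t.Desc v u) : u = v := by
  by_contra hne
  have := h.depth_lt hne
  have := h'.depth_lt (Ne.symm hne)
  omega

/-- The ancestors of a vertex form a chain. -/
theorem Desc.total {t : WRTree V} {u v w : V} (h : t.Desc u v) (h' : t.Desc u w) :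
    t.Desc v w ∨ t.Desc w v := by
  obtain ⟨n, rfl⟩ := h
  obtain ⟨m, rfl⟩ := h'
  rcases le_total n m with hnm | hnm
  · left
    refine ⟨m - n, ?_⟩
    rw [← Function.iterate_add_apply, Nat.sub_add_cancel hnm]
  · right
    refine ⟨n - m, ?_⟩
    rw [← Function.iterate_add_apply, Nat.sub_add_cancel hnm]

theorem IsChild.eq_of_desc {t : WRTree V} {u v w r : V} (hv : t.IsChild v r)
    (hw : t.IsChild w r) (h : t.Desc u v) (h' : t.Desc u w) : v = w := by
  by_contra hne
  have h1 := hv.depth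
  have h2 := hw.depth
  rcases h.total h' with h | h
  · have := h.depth_lt hne; omega
  · have := h.depth_lt (Ne.symm hne); omega

theorem IsChild.not_desc {t : WRTree V} {v r : V} (hv : t.IsChild v r) : ¬ t.Desc r v := by
  intro h
  have h1 := hv.depth
  have : r = v := h.antisymm hv.desc
  subst this
  omega

theorem Desc.exists_child {t : WRTree V} {u r : V} (h : t.Desc u r) (hne : u ≠ r) :
    ∃ v, t.IsChild v r ∧ t.Desc u v := by
  revert hne
  refine Desc.induction (p := fun u => u ≠ r → ∃ v, t.IsChild v r ∧ t.Desc u v)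
    (fun h => absurd rfl h) ?_ h
  intro u _ hur _ ih _
  by_cases h : t.parent u = r
  · exact ⟨u, ⟨hur, h⟩, Desc.refl t u⟩
  · obtain ⟨v, hv, huv⟩ := ih h
    exact ⟨v, hv, (t.desc_parent u).trans huv⟩

/-! Tubes -/

/-- `X` is a tube with root `r`: the vertex `r` is the only vertex of `X` without parent in `X`. -/
def IsTubeAt (t : WRTree V) (r : V) (X : Finset V) : Prop :=
  t.IsRootOf r X ∧ ∀ u, t.IsRootOf u X → u = r

theorem IsTubeAt.mem {t : WRTree V} {r : V} {X : Finset V} (h : t.IsTubeAt r X) : r ∈ X := h.1.1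

theorem IsTubeAt.parent_mem {t : WRTree V} {r u : V} {X : Finset V} (h : t.IsTubeAt r X)
    (hu : u ∈ X) (hne : u ≠ r) : u ≠ t.root ∧ t.parent u ∈ X := by
  by_contra hcon
  refine hne (h.2 u ⟨hu, ?_⟩)
  by_cases hr : u = t.root
  · exact Or.inl hr
  · exact Or.inr fun hp => hcon ⟨hr, hp⟩

theorem IsTubeAt.desc {t : WRTree V} {r u : V} {X : Finset V} (h : t.IsTubeAt r X)
    (hu : u ∈ X) : t.Desc u r := by
  revert hu
  refine t.parent_induction (p := fun u => u ∈ X → t.Desc u r) ?_ ?_ u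
  · intro hu
    rw [h.2 _ ⟨hu, Or.inl rfl⟩]
    exact Desc.refl t r
  · intro v _ ih hv
    by_cases hvr : v = r
    · rw [hvr]; exact Desc.refl t r
    · exact (t.desc_parent v).trans (ih (h.parent_mem hv hvr).2)

/-- Climbing from u to r stays inside X and must pass through v, which lies between them. -/
theorem IsTubeAt.convex {t : WRTree V} {r u v : V} {X : Finset V} (h : t.IsTubeAt r X)
    (hu : u ∈ X) (hv : t.Desc v r) (huv : t.Desc u v) : v ∈ X := by
  revert hu
  refine Desc.induction (p := fun u => u ∈ X → v ∈ X) id ?_ huv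
  intro u huv _ hd ih hu
  by_cases hur : u = r
  · subst hur
    exact absurd (((t.desc_parent u).trans hd).antisymm hv) huv
  · exact ih (h.parent_mem hu hur).2

/-- The hypothesis `hd` keeps the parent of r out of X: that parent would be a descendant of r,
contradicting depth. -/
theorem isTubeAt_of {t : WRTree V} {r : V} {X : Finset V} (hr : r ∈ X)
    (h : ∀ u ∈ X, u ≠ r → u ≠ t.root ∧ t.parent u ∈ X) (hd : ∀ u ∈ X, t.Desc u r) :
    t.IsTubeAt r X := by
  refine ⟨⟨hr, ?_⟩, ?_⟩
  · by_contra hcon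
    push Not at hcon
    have h1 := t.depth_of_ne_root hcon.1
    have h2 := (hd _ hcon.2).antisymm (t.desc_parent r)
    rw [h2] at h1
    omega
  · rintro u ⟨hu, hu'⟩
    by_contra hne
    have := h u hu hne
    tauto

theorem graph_adj (t : WRTree V) (u v : V) :
    t.graph.Adj u v ↔ t.IsChild u v ∨ t.IsChild v u := by
  unfold graph IsChild
  rw [SimpleGraph.fromRel_adj]
  constructor
  · rintro ⟨hne, h | h⟩
    · left
      refine ⟨?_, h⟩
      rintro rfl
      exact hne (t.parent_root.symm.trans h)
    · right
      refine ⟨?_, h⟩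
      rintro rfl
      exact hne (h.symm.trans t.parent_root)
  · rintro (h | h)
    · have := IsChild.depth (t := t) h
      exact ⟨by rintro rfl; omega, Or.inl h.2⟩
    · have := IsChild.depth (t := t) h
      exact ⟨by rintro rfl; omega, Or.inr h.2⟩

theorem IsTubeAt.isTube {t : WRTree V} {r : V} {X : Finset V} (h : t.IsTubeAt r X) :
    t.IsTube X := by
  have key : ∀ u, t.Desc u r → ∀ hu : u ∈ X,
      (t.graph.induce (X : Set V)).Reachable ⟨u, hu⟩ ⟨r, h.mem⟩ := by
    intro u hd
    refine Desc.induction (p := fun u => ∀ hu : u ∈ X,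
      (t.graph.induce (X : Set V)).Reachable ⟨u, hu⟩ ⟨r, h.mem⟩) (fun _ => .refl _) ?_ hd
    intro u hur hurt _ ih hu
    have hp := (h.parent_mem hu hur).2
    refine SimpleGraph.Reachable.trans (SimpleGraph.Adj.reachable ?_) (ih hp)
    simp only [SimpleGraph.comap_adj, Function.Embedding.subtype_apply]
    exact (t.graph_adj _ _).2 (Or.inl ⟨hurt, rfl⟩)
  unfold IsTube
  have : Nonempty (X : Set V) := ⟨⟨r, h.mem⟩⟩
  refine ⟨fun a b => ?_⟩
  exact (key a.1 (h.desc a.2) a.2).trans (key b.1 (h.desc b.2) b.2).symm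

/-- The root is a vertex of minimal depth. Walking from it along edges inside X preserves the
invariant that the current vertex descends from r and that the whole ancestral chain up to r lies in
X; minimality excludes stepping above r. -/
theorem IsTube.exists_isTubeAt {t : WRTree V} {X : Finset V} (h : t.IsTube X) :
    ∃ r, t.IsTubeAt r X := by
  obtain ⟨⟨x, hx⟩⟩ := h.nonempty
  obtain ⟨r, hr, hmin⟩ := Finset.exists_min_image X t.depth ⟨x, hx⟩
  have key : ∀ u, ∀ hu : u ∈ X, t.Desc u r ∧ (u ≠ r → u ≠ t.root ∧ t.parent u ∈ X) ∧
      ∀ v, t.Desc u v → t.Desc v r → v ∈ X := by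
    intro u hu
    have hreach := h.preconnected ⟨r, hr⟩ ⟨u, hu⟩
    rw [SimpleGraph.reachable_iff_reflTransGen] at hreach
    have : ∀ w : (X : Set V), Relation.ReflTransGen (t.graph.induce (X : Set V)).Adj ⟨r, hr⟩ w →
        t.Desc w r ∧ (w.1 ≠ r → w.1 ≠ t.root ∧ t.parent w ∈ X) ∧
          ∀ v, t.Desc w v → t.Desc v r → v ∈ X := by
      intro w hw
      induction hw with
      | refl =>
        exact ⟨Desc.refl t r, fun h => absurd rfl h, fun v h1 h2 => (h1.antisymm h2) ▸ hr⟩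
      | @tail b c _ hbc ih =>
        obtain ⟨b, hb⟩ := b
        obtain ⟨c, hc⟩ := c
        simp only [SimpleGraph.comap_adj, Function.Embedding.subtype_apply] at hbc ih ⊢
        rcases (t.graph_adj _ _).1 hbc with hbc | hbc
        · have hbr : b ≠ r := by
            rintro rfl
            have := hmin c hc
            have := hbc.depth
            omega
          have hcr : t.Desc c r := by
            rcases ih.1.eq_or_parent with h | h
            · exact absurd h hbr
            · exact hbc.2 ▸ h.2
          refine ⟨hcr, fun hne => ?_, fun v h1 h2 => ih.2.2 v (hbc.desc.trans h1) h2⟩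
          rcases hcr.eq_or_parent with h | h
          · exact absurd h hne
          · exact ⟨h.1, ih.2.2 _ (hbc.desc.trans (t.desc_parent c)) h.2⟩
        · refine ⟨hbc.desc.trans ih.1, fun _ => ⟨hbc.1, hbc.2 ▸ hb⟩, fun v h1 h2 => ?_⟩
          rcases h1.eq_or_parent with h | h
          · exact h ▸ hc
          · exact ih.2.2 v (hbc.2 ▸ h.2) h2
    exact this ⟨u, hu⟩ hreach
  exact ⟨r, isTubeAt_of hr (fun u hu => (key u hu).2.1) fun u hu => (key u hu).1⟩

section Finite

variable [Fintype V]

open Classical in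
/-- The set of descendants of a vertex. -/
noncomputable def descSet (t : WRTree V) (v : V) : Finset V :=
  Finset.univ.filter fun u => t.Desc u v

@[simp]
theorem mem_descSet {t : WRTree V} {u v : V} : u ∈ t.descSet v ↔ t.Desc u v := by
  simp [descSet]

open Classical in
/-- The set of children of a vertex. -/
noncomputable def children (t : WRTree V) (v : V) : Finset V :=
  Finset.univ.filter fun u => t.IsChild u v

@[simp]
theorem mem_children {t : WRTree V} {u v : V} : u ∈ t.children v ↔ t.IsChild u v := by
  simp [children]

theorem descSet_root (t : WRTree V) : t.descSet t.root = Finset.univ := by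
  ext u
  simp [t.desc_root u]

theorem isTubeAt_univ (t : WRTree V) : t.IsTubeAt t.root Finset.univ :=
  isTubeAt_of (Finset.mem_univ _) (fun _ _ h => ⟨h, Finset.mem_univ _⟩) fun u _ => t.desc_root u

variable [DecidableEq V]

theorem card_children (t : WRTree V) (v : V) : (t.children v).card = t.outDegree v := by
  unfold children outDegree IsChild
  congr!

theorem IsTubeAt.inter_descSet {t : WRTree V} {r v : V} {X : Finset V} (h : t.IsTubeAt r X)
    (hv : v ∈ X) : t.IsTubeAt v (X ∩ t.descSet v) := by
  refine isTubeAt_of (by simp [hv, Desc.refl]) ?_ (by simp)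
  intro u hu huv
  simp only [Finset.mem_inter, mem_descSet] at hu ⊢
  rcases hu.2.eq_or_parent with h' | h'
  · exact absurd h' huv
  · refine ⟨h'.1, ?_, h'.2⟩
    refine (h.parent_mem hu.1 ?_).2
    rintro rfl
    exact huv (hu.2.antisymm (h.desc hv))

theorem IsTubeAt.sdiff_descSet {t : WRTree V} {r v : V} {X : Finset V} (h : t.IsTubeAt r X)
    (hv : v ∈ X) (hne : v ≠ r) : t.IsTubeAt r (X \ t.descSet v) := by
  refine isTubeAt_of ?_ ?_ ?_
  · simp only [Finset.mem_sdiff, mem_descSet]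
    exact ⟨h.mem, fun h' => hne ((h.desc hv).antisymm h')⟩
  · intro u hu hur
    simp only [Finset.mem_sdiff, mem_descSet] at hu ⊢
    have := h.parent_mem hu.1 hur
    exact ⟨this.1, this.2, fun h' => hu.2 ((t.desc_parent u).trans h')⟩
  · intro u hu
    simp only [Finset.mem_sdiff] at hu
    exact h.desc hu.1

/-- If a tube with root `r` is partitioned by two tubes, then the one that does not contain `r`
consists of all descendants of its root. -/
theorem IsTubeAt.eq_of_partition {t : WRTree V} {r r₁ v : V} {X b₁ b₂ : Finset V}
    (h : t.IsTubeAt r X) (h₁ : t.IsTubeAt r₁ b₁) (h₂ : t.IsTubeAt v b₂)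
    (hd : Disjoint b₁ b₂) (hu : b₁ ∪ b₂ = X) (hr : r ∈ b₁) :
    v ∈ X ∧ v ≠ r ∧ b₂ = X ∩ t.descSet v ∧ b₁ = X \ t.descSet v := by
  have hvX : v ∈ X := hu ▸ Finset.mem_union_right _ h₂.mem
  have hvr : v ≠ r := by
    rintro rfl
    exact Finset.disjoint_left.1 hd hr h₂.mem
  have hr₁ : r₁ = r := by
    refine (h₁.2 r ⟨hr, ?_⟩).symm
    rcases h.1.2 with h' | h'
    · exact Or.inl h'
    · exact Or.inr fun hp => h' (hu ▸ Finset.mem_union_left _ hp)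
  subst hr₁
  have e2 : b₂ = X ∩ t.descSet v := by
    ext u
    simp only [Finset.mem_inter, mem_descSet]
    constructor
    · intro hub
      exact ⟨hu ▸ Finset.mem_union_right _ hub, h₂.desc hub⟩
    · rintro ⟨hux, huv⟩
      rw [← hu, Finset.mem_union] at hux
      rcases hux with hux | hux
      · exact absurd h₂.mem (Finset.disjoint_left.1 hd (h₁.convex hux (h.desc hvX) huv))
      · exact hux
  refine ⟨hvX, hvr, e2, ?_⟩
  have : X \ t.descSet v = X \ b₂ := by
    rw [e2, Finset.sdiff_inter_self_left]
  rw [this, ← hu, Finset.union_sdiff_right, Finset.sdiff_eq_self_of_disjoint hd]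

end Finite

end WRTree

/-! ### Tubings of a tube and their decomposition by cutting an edge -/

namespace WRTree

variable {V : Type*}

theorem IsTube.nonempty {t : WRTree V} {b : Finset V} (h : t.IsTube b) : b.Nonempty := by
  obtain ⟨r, hr⟩ := h.exists_isTubeAt
  exact ⟨r, hr.mem⟩

section Decidable

variable [DecidableEq V]

/-- A binary tubing of the tree induced on a set `X` of vertices. -/
structure IsTubingOn (t : WRTree V) (X : Finset V) (τ : Finset (Finset V)) : Prop where
  isTube : ∀ b ∈ τ, t.IsTube b
  subset : ∀ b ∈ τ, b ⊆ X
  mem : X ∈ τ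
  split : ∀ b ∈ τ, b.card = 1 ∨
    ∃ b₁ ∈ τ, ∃ b₂ ∈ τ, b₁ ≠ b ∧ b₂ ≠ b ∧ Disjoint b₁ b₂ ∧ b₁ ∪ b₂ = b
  nested : ∀ b ∈ τ, ∀ b' ∈ τ, Disjoint b b' ∨ b ⊆ b' ∨ b' ⊆ b

theorem IsTubingOn.eq_or_subset {t : WRTree V} {X b b₁ b₂ : Finset V} {τ : Finset (Finset V)}
    (h : t.IsTubingOn X τ) (h₁ : b₁ ∈ τ) (h₂ : b₂ ∈ τ) (hu : b₁ ∪ b₂ = X) (hb : b ∈ τ) :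
    b = X ∨ b ⊆ b₁ ∨ b ⊆ b₂ := by
  have hbX : b ⊆ b₁ ∪ b₂ := hu ▸ h.subset b hb
  rcases h.nested b hb b₁ h₁ with h' | h' | h'
  · exact Or.inr (Or.inr (h'.left_le_of_le_sup_left hbX))
  · exact Or.inr (Or.inl h')
  · rcases h.nested b hb b₂ h₂ with h'' | h'' | h''
    · exact Or.inr (Or.inl (h''.left_le_of_le_sup_right hbX))
    · exact Or.inr (Or.inr h'')
    · exact Or.inl ((h.subset b hb).antisymm (hu ▸ Finset.union_subset h' h''))

theorem IsTubingOn.filter {t : WRTree V} {X Y : Finset V} {τ : Finset (Finset V)}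
    (h : t.IsTubingOn X τ) (hY : Y ∈ τ) : t.IsTubingOn Y (τ.filter (· ⊆ Y)) where
  isTube b hb := h.isTube b (Finset.mem_filter.1 hb).1
  subset b hb := (Finset.mem_filter.1 hb).2
  mem := Finset.mem_filter.2 ⟨hY, subset_rfl⟩
  split b hb := by
    rw [Finset.mem_filter] at hb
    rcases h.split b hb.1 with h' | ⟨b₁, h₁, b₂, h₂, n₁, n₂, hd, hu⟩
    · exact Or.inl h'
    · refine Or.inr ⟨b₁, ?_, b₂, ?_, n₁, n₂, hd, hu⟩
      · exact Finset.mem_filter.2 ⟨h₁, (hu ▸ Finset.subset_union_left : b₁ ⊆ b).trans hb.2⟩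
      · exact Finset.mem_filter.2 ⟨h₂, (hu ▸ Finset.subset_union_right : b₂ ⊆ b).trans hb.2⟩
  nested b hb b' hb' := h.nested b (Finset.mem_filter.1 hb).1 b' (Finset.mem_filter.1 hb').1

theorem bStat_eq_zero {t : WRTree V} {X : Finset V} {τ : Finset (Finset V)} {u : V}
    (h : t.IsTubingOn X τ) (hu : u ∉ X) : t.bStat τ u = 0 := by
  classical
  unfold bStat
  rw [Finset.card_eq_zero, Finset.filter_eq_empty_iff]
  exact fun b hb h' => hu (h.subset b hb h'.1)

theorem IsTubingOn.bStat_pos {t : WRTree V} {X : Finset V} {τ : Finset (Finset V)} {r : V}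
    (h : t.IsTubingOn X τ) (hr : t.IsTubeAt r X) : 0 < t.bStat τ r := by
  classical
  unfold bStat
  rw [Finset.card_pos]
  exact ⟨X, Finset.mem_filter.2 ⟨h.mem, hr.1⟩⟩

/-- Tubes from different pieces are disjoint and X contains them all, so nestedness is inherited;
both pieces are nonempty, so they split X properly. -/
theorem IsTubingOn.join {t : WRTree V} {X Y : Finset V} {τ₁ τ₂ : Finset (Finset V)}
    (hX : t.IsTube X) (h₁ : t.IsTubingOn (X ∩ Y) τ₁) (h₂ : t.IsTubingOn (X \ Y) τ₂) :
    t.IsTubingOn X (insert X (τ₁ ∪ τ₂)) := by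
  have hd : Disjoint (X ∩ Y) (X \ Y) :=
    Finset.disjoint_left.2 fun u h h' => (Finset.mem_sdiff.1 h').2 (Finset.mem_inter.1 h).2
  have hu : X ∩ Y ∪ X \ Y = X := by
    ext u; simp only [Finset.mem_union, Finset.mem_inter, Finset.mem_sdiff]; tauto
  have hne₁ := (h₁.isTube _ h₁.mem).nonempty
  have hne₂ := (h₂.isTube _ h₂.mem).nonempty
  have hsub : ∀ b ∈ insert X (τ₁ ∪ τ₂), b ⊆ X := by
    intro b hb
    simp only [Finset.mem_insert, Finset.mem_union] at hb
    rcases hb with rfl | hb | hb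
    · exact subset_rfl
    · exact (h₁.subset b hb).trans Finset.inter_subset_left
    · exact (h₂.subset b hb).trans Finset.sdiff_subset
  refine ⟨?_, hsub, Finset.mem_insert_self _ _, ?_, ?_⟩
  · intro b hb
    simp only [Finset.mem_insert, Finset.mem_union] at hb
    rcases hb with rfl | hb | hb
    · exact hX
    · exact h₁.isTube b hb
    · exact h₂.isTube b hb
  · intro b hb
    have hb' := hb
    simp only [Finset.mem_insert, Finset.mem_union] at hb
    rcases hb with rfl | hb | hb
    · refine Or.inr ⟨b ∩ Y, ?_, b \ Y, ?_, ?_, ?_, hd, hu⟩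
      · simp [h₁.mem]
      · simp [h₂.mem]
      · intro h
        rw [h] at hd
        exact hne₂.ne_empty (Finset.disjoint_self_iff_empty _ |>.1
          (hd.mono_left Finset.sdiff_subset))
      · intro h
        rw [h] at hd
        exact hne₁.ne_empty (Finset.disjoint_self_iff_empty _ |>.1
          (hd.mono_right Finset.inter_subset_left))
    · rcases h₁.split b hb with h' | ⟨b₁, k₁, b₂, k₂, h'⟩
      · exact Or.inl h'
      · exact Or.inr ⟨b₁, by simp [k₁], b₂, by simp [k₂], h'⟩
    · rcases h₂.split b hb with h' | ⟨b₁, k₁, b₂, k₂, h'⟩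
      · exact Or.inl h'
      · exact Or.inr ⟨b₁, by simp [k₁], b₂, by simp [k₂], h'⟩
  · intro b hb b' hb'
    have s := hsub b hb
    have s' := hsub b' hb'
    simp only [Finset.mem_insert, Finset.mem_union] at hb hb'
    rcases hb with rfl | hb | hb
    · exact Or.inr (Or.inr s')
    · rcases hb' with rfl | hb' | hb'
      · exact Or.inr (Or.inl s)
      · exact h₁.nested b hb b' hb'
      · exact Or.inl (hd.mono (h₁.subset b hb) (h₂.subset b' hb'))
    · rcases hb' with rfl | hb' | hb'
      · exact Or.inr (Or.inl s)
      · exact Or.inl (hd.symm.mono (h₂.subset b hb) (h₁.subset b' hb'))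
      · exact h₂.nested b hb b' hb'

theorem IsTubingOn.filter_join_left {t : WRTree V} {X Y : Finset V} {τ₁ τ₂ : Finset (Finset V)}
    (h₁ : t.IsTubingOn (X ∩ Y) τ₁) (h₂ : t.IsTubingOn (X \ Y) τ₂) :
    (insert X (τ₁ ∪ τ₂)).filter (· ⊆ X ∩ Y) = τ₁ := by
  have hd : Disjoint (X ∩ Y) (X \ Y) :=
    Finset.disjoint_left.2 fun u h h' => (Finset.mem_sdiff.1 h').2 (Finset.mem_inter.1 h).2
  have key : ∀ b, b ⊆ X \ Y → b.Nonempty → ¬ b ⊆ X ∩ Y := fun b hb ⟨u, hu⟩ h =>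
    Finset.disjoint_left.1 hd (h hu) (hb hu)
  ext b
  simp only [Finset.mem_filter, Finset.mem_insert, Finset.mem_union]
  constructor
  · rintro ⟨rfl | h | h, hb⟩
    · exact absurd (Finset.sdiff_subset.trans hb)
        (key _ subset_rfl (h₂.isTube _ h₂.mem).nonempty)
    · exact h
    · exact absurd hb (key b (h₂.subset b h) (h₂.isTube b h).nonempty)
  · exact fun h => ⟨Or.inr (Or.inl h), h₁.subset b h⟩

theorem IsTubingOn.filter_join_right {t : WRTree V} {X Y : Finset V}
    {τ₁ τ₂ : Finset (Finset V)}
    (h₁ : t.IsTubingOn (X ∩ Y) τ₁) (h₂ : t.IsTubingOn (X \ Y) τ₂) :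
    (insert X (τ₁ ∪ τ₂)).filter (· ⊆ X \ Y) = τ₂ := by
  have hd : Disjoint (X ∩ Y) (X \ Y) :=
    Finset.disjoint_left.2 fun u h h' => (Finset.mem_sdiff.1 h').2 (Finset.mem_inter.1 h).2
  have key : ∀ b, b ⊆ X ∩ Y → b.Nonempty → ¬ b ⊆ X \ Y := fun b hb ⟨u, hu⟩ h =>
    Finset.disjoint_left.1 hd (hb hu) (h hu)
  ext b
  simp only [Finset.mem_filter, Finset.mem_insert, Finset.mem_union]
  constructor
  · rintro ⟨rfl | h | h, hb⟩
    · exact absurd (Finset.inter_subset_left.trans hb)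
        (key _ subset_rfl (h₁.isTube _ h₁.mem).nonempty)
    · exact absurd hb (key b (h₁.subset b h) (h₁.isTube b h).nonempty)
    · exact h
  · exact fun h => ⟨Or.inr (Or.inr h), h₂.subset b h⟩

end Decidable

variable [Fintype V] [DecidableEq V]

open Classical in
/-- The finite set of tubings of the tree induced on `X`. -/
noncomputable def tubingsOn (t : WRTree V) (X : Finset V) : Finset (Finset (Finset V)) :=
  Finset.univ.filter fun τ => t.IsTubingOn X τ

@[simp]
theorem mem_tubingsOn {t : WRTree V} {X : Finset V} {τ : Finset (Finset V)} :
    τ ∈ t.tubingsOn X ↔ t.IsTubingOn X τ := by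
  simp [tubingsOn]

theorem tubingsOn_univ (t : WRTree V) : t.tubingsOn Finset.univ = t.tubings := by
  ext τ
  simp only [tubings, mem_tubingsOn, Finset.mem_filter, Finset.mem_univ, true_and]
  exact ⟨fun h => ⟨h.isTube, h.mem, h.split, h.nested⟩,
    fun h => ⟨h.isTube, fun b _ => b.subset_univ, h.univ_mem, h.split, h.nested⟩⟩

/-- A tubing of a tube with at least two vertices is obtained, in a unique way, from tubings of the
two tubes that arise by cutting the edge above a vertex `v`. -/
theorem sum_tubingsOn {M : Type*} [AddCommMonoid M] {t : WRTree V} {r : V} {X : Finset V}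
    (h : t.IsTubeAt r X) (hX : X.card ≠ 1) (f : Finset (Finset V) → M) :
    ∑ τ ∈ t.tubingsOn X, f τ =
      ∑ v ∈ X.erase r, ∑ τ₁ ∈ t.tubingsOn (X ∩ t.descSet v),
        ∑ τ₂ ∈ t.tubingsOn (X \ t.descSet v), f (insert X (τ₁ ∪ τ₂)) := by
  simp_rw [← Finset.sum_product']
  rw [Finset.sum_sigma']
  symm
  refine Finset.sum_bij (fun a _ => insert X (a.2.1 ∪ a.2.2)) ?_ ?_ ?_ (fun _ _ => rfl)
  · rintro ⟨v, τ₁, τ₂⟩ ha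
    simp only [Finset.mem_sigma, Finset.mem_product, mem_tubingsOn] at ha ⊢
    exact ha.2.1.join h.isTube ha.2.2
  · rintro ⟨v, τ₁, τ₂⟩ ha ⟨v', τ₁', τ₂'⟩ ha' heq
    simp only [Finset.mem_sigma, Finset.mem_product, mem_tubingsOn, Finset.mem_erase]
      at ha ha' heq
    obtain ⟨⟨hne, hv⟩, h₁, h₂⟩ := ha
    obtain ⟨⟨hne', hv'⟩, h₁', h₂'⟩ := ha'
    -- The tubing determines the cut. If v' were not below v, the upper piece of the cut at v would
    -- contain both r and v', but no tube of the second tubing contains both, except X itself. By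
    -- symmetry and antisymmetry v = v'.
    have key : ∀ {v v' : V} {τ₁ τ₂ τ₁' τ₂' : Finset (Finset V)}, v ≠ r → v ∈ X → v' ≠ r →
        v' ∈ X →
        t.IsTubingOn (X ∩ t.descSet v) τ₁ → t.IsTubingOn (X \ t.descSet v) τ₂ →
        t.IsTubingOn (X ∩ t.descSet v') τ₁' → t.IsTubingOn (X \ t.descSet v') τ₂' →
        insert X (τ₁ ∪ τ₂) = insert X (τ₁' ∪ τ₂') → t.Desc v' v := by
      intro v v' τ₁ τ₂ τ₁' τ₂' hne hv hne' hv' h₁ h₂ h₁' h₂' heq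
      have hmem : X \ t.descSet v ∈ insert X (τ₁' ∪ τ₂') := by
        rw [← heq]; simp [h₂.mem]
      have hrm := (h.sdiff_descSet hv hne).mem
      have hrm' := (h.sdiff_descSet hv' hne').mem
      by_contra hcon
      have hv'm : v' ∈ X \ t.descSet v := by simp [hv', hcon]
      simp only [Finset.mem_insert, Finset.mem_union] at hmem
      rcases hmem with hmem | hmem | hmem
      · have : v ∈ X \ t.descSet v := (Finset.ext_iff.1 hmem v).2 hv
        simp [Desc.refl] at this
      · have := h₁'.subset _ hmem hrm
        simp only [Finset.mem_inter, Finset.mem_sdiff] at this hrm'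
        exact hrm'.2 this.2
      · have := h₂'.subset _ hmem hv'm
        simp [Desc.refl] at this
    have e : v = v' := (key hne' hv' hne hv h₁' h₂' h₁ h₂ heq.symm).antisymm
      (key hne hv hne' hv' h₁ h₂ h₁' h₂' heq)
    subst e
    have e₁ : τ₁ = τ₁' := by
      rw [← h₁.filter_join_left h₂, heq, h₁'.filter_join_left h₂']
    have e₂ : τ₂ = τ₂' := by
      rw [← h₁.filter_join_right h₂, heq, h₁'.filter_join_right h₂']
    rw [e₁, e₂]
  · intro τ hτ
    rw [mem_tubingsOn] at hτ
    have key : ∃ b₁ ∈ τ, ∃ b₂ ∈ τ, b₁ ∪ b₂ = X ∧ Disjoint b₁ b₂ ∧ r ∈ b₁ := by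
      rcases hτ.split X hτ.mem with h' | ⟨b₁, h₁, b₂, h₂, -, -, hd, hu⟩
      · exact absurd h' hX
      · have hr := h.mem
        rw [← hu, Finset.mem_union] at hr
        rcases hr with hr | hr
        · exact ⟨b₁, h₁, b₂, h₂, hu, hd, hr⟩
        · exact ⟨b₂, h₂, b₁, h₁, Finset.union_comm b₁ b₂ ▸ hu, hd.symm, hr⟩
    obtain ⟨b₁, h₁, b₂, h₂, hu, hd, hr⟩ := key
    obtain ⟨r₁, hr₁⟩ := (hτ.isTube b₁ h₁).exists_isTubeAt
    obtain ⟨v, hv⟩ := (hτ.isTube b₂ h₂).exists_isTubeAt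
    obtain ⟨hvX, hvr, e₂, e₁⟩ := h.eq_of_partition hr₁ hv hd hu hr
    -- Of the two tubes partitioning X, b₂ is the one without r, hence the full part of X below its
    -- root v.
    refine ⟨⟨v, τ.filter (· ⊆ b₂), τ.filter (· ⊆ b₁)⟩, ?_, ?_⟩
    · simp only [Finset.mem_sigma, Finset.mem_product, mem_tubingsOn, Finset.mem_erase]
      rw [← e₁, ← e₂]
      exact ⟨⟨hvr, hvX⟩, hτ.filter h₂, hτ.filter h₁⟩
    · ext b
      simp only [Finset.mem_insert, Finset.mem_union, Finset.mem_filter]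
      constructor
      · rintro (rfl | h' | h')
        · exact hτ.mem
        · exact h'.1
        · exact h'.1
      · intro hb
        have := hτ.eq_or_subset h₁ h₂ hu hb
        tauto

theorem tubingsOn_of_card_eq_one {t : WRTree V} {r : V} {X : Finset V} (h : t.IsTubeAt r X)
    (hX : X.card = 1) : t.tubingsOn X = {{X}} := by
  ext τ
  simp only [mem_tubingsOn, Finset.mem_singleton]
  constructor
  · intro hτ
    ext b
    rw [Finset.mem_singleton]
    constructor
    · intro hb
      refine Finset.eq_of_subset_of_card_le (hτ.subset b hb) ?_
      rw [hX]
      exact (hτ.isTube b hb).nonempty.card_pos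
    · rintro rfl
      exact hτ.mem
  · rintro rfl
    refine ⟨?_, ?_, by simp, ?_, ?_⟩ <;> simp [h.isTube, hX]

/-- The only new tube is X, with root r, and no tube is counted in both pieces. -/
theorem bStat_join {t : WRTree V} {r v : V} {X : Finset V} {τ₁ τ₂ : Finset (Finset V)}
    (h : t.IsTubeAt r X) (hv : v ∈ X) (hne : v ≠ r)
    (h₁ : t.IsTubingOn (X ∩ t.descSet v) τ₁) (h₂ : t.IsTubingOn (X \ t.descSet v) τ₂) (u : V) :
    t.bStat (insert X (τ₁ ∪ τ₂)) u =
      (if u = r then 1 else 0) + (t.bStat τ₁ u + t.bStat τ₂ u) := by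
  classical
  unfold bStat
  have hd : Disjoint τ₁ τ₂ := by
    rw [Finset.disjoint_left]
    intro b hb hb'
    obtain ⟨x, hx⟩ := (h₁.isTube b hb).nonempty
    exact (Finset.mem_sdiff.1 (h₂.subset b hb' hx)).2 (Finset.mem_inter.1 (h₁.subset b hb hx)).2
  have hX : X ∉ τ₁ ∪ τ₂ := by
    rw [Finset.mem_union]
    rintro (hm | hm)
    · have h3 := h₁.subset X hm h.mem
      have h4 := (h.sdiff_descSet hv hne).mem
      rw [Finset.mem_sdiff] at h4
      exact h4.2 (Finset.mem_inter.1 h3).2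
    · have := h₂.subset X hm hv
      simp [Desc.refl] at this
  rw [Finset.filter_insert, Finset.filter_union, ← Finset.card_union_of_disjoint
    (Finset.disjoint_filter_filter hd)]
  split_ifs with h3 h4 h4
  · rw [Finset.card_insert_of_notMem, add_comm]
    rw [← Finset.filter_union, Finset.mem_filter]
    exact fun h' => hX h'.1
  · exact absurd (h.2 u h3) h4
  · exact absurd (h4 ▸ h.1) h3
  · rw [zero_add]

end WRTree

/-! ### The insertion operator on divided powers of L -/

open Polynomial

section Insertion

variable {K : Type*} [CommRing K] [Algebra ℚ K]

/-- The divided power `L ^ n / n!`. -/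
noncomputable def divPow (K : Type*) [CommRing K] [Algebra ℚ K] (n : ℕ) : K[X] :=
  (n.factorial : ℚ)⁻¹ • (X : K[X]) ^ n

@[simp]
theorem divPow_zero : divPow K 0 = 1 := by simp [divPow]

theorem derivative_divPow_succ (n : ℕ) : derivative (divPow K (n + 1)) = divPow K n := by
  unfold divPow
  rw [derivative_smul, derivative_X_pow, Nat.add_sub_cancel, ← smul_eq_C_mul,
    Nat.cast_smul_eq_nsmul, ← Nat.cast_smul_eq_nsmul ℚ, smul_smul]
  congr 1
  rw [Nat.factorial_succ]
  have : (n.factorial : ℚ) ≠ 0 := by positivity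
  push_cast
  field_simp

theorem coeff_divPow (n i : ℕ) :
    (divPow K n).coeff i = if i = n then algebraMap ℚ K (n.factorial : ℚ)⁻¹ else 0 := by
  rw [divPow, coeff_smul, coeff_X_pow, Algebra.smul_def]
  split_ifs <;> simp

/-- The pole of F shifts the index to n + 1, and the term i = 0 disappears because e^{Lρ} - 1 has no
constant term in ρ. -/
theorem coeff_expSubOne_mul_mellinSeries (a : ℕ → K) (n : ℕ) :
    (expSubOne K * mellinSeries a).coeff (n : ℤ) =
      ∑ i ∈ Finset.Icc 1 (n + 1), C (a (n + 1 - i)) * divPow K i := by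
  rw [expSubOne, mellinSeries, mul_left_comm, HahnSeries.coeff_single_mul, one_mul, ← map_mul,
    show (n : ℤ) - -1 = ((n + 1 : ℕ) : ℤ) by push_cast; ring,
    LaurentSeries.coeff_coe_powerSeries, PowerSeries.coeff_mul]
  rw [Finset.Nat.sum_antidiagonal_eq_sum_range_succ (fun i j =>
    PowerSeries.coeff i (PowerSeries.rescale (X : K[X]) (PowerSeries.exp K[X]) - 1) *
      PowerSeries.coeff j (PowerSeries.mk fun i => C (a i))) (n + 1),
    Finset.sum_range_eq_add_Ico _ (Nat.succ_pos _)]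
  have : Finset.Ico 1 (n + 1).succ = Finset.Icc 1 (n + 1) := by
    ext; simp only [Finset.mem_Ico, Finset.mem_Icc]; omega
  rw [this]
  simp only [map_sub, PowerSeries.coeff_rescale, PowerSeries.coeff_exp, PowerSeries.coeff_one,
    PowerSeries.coeff_mk]
  simp only [pow_zero, Nat.factorial_zero, Nat.cast_one, div_one, map_one, mul_one, if_true,
    sub_self, zero_mul, zero_add]
  refine Finset.sum_congr rfl fun i hi => ?_
  rw [if_neg (by rw [Finset.mem_Icc] at hi; omega), sub_zero, mul_comm, divPow, Algebra.smul_def,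
    one_div, mul_comm (X ^ i)]

/-- `insertion a` as a linear map. -/
noncomputable def insertionHom (a : ℕ → K) : K[X] →ₗ[K] K[X] where
  toFun := insertion a
  map_add' p q := by
    unfold insertion
    rw [map_add, LinearMap.add_apply, HahnSeries.coeff_add]
  map_smul' r p := by
    unfold insertion
    rw [map_smul, LinearMap.smul_apply, HahnSeries.coeff_smul, RingHom.id_apply]

/-- The n-th derivative at ρ = 0 divided by n! extracts the coefficient of ρ^n. With n + 1 = b(τ)
the right side is the sum in the definition of φ_L. -/
theorem insertionHom_divPow (a : ℕ → K) (n : ℕ) :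
    insertionHom a (divPow K n) =
      ∑ i ∈ Finset.Icc 1 (n + 1), C (a (n + 1 - i)) * divPow K i := by
  rw [← coeff_expSubOne_mul_mellinSeries]
  change insertion a _ = _
  have h : divPow K n = algebraMap ℚ K (n.factorial : ℚ)⁻¹ • X ^ n := by
    rw [divPow, algebraMap_smul]
  have hf : (n.factorial : ℚ) ≠ 0 := by positivity
  unfold insertion
  rw [h, map_smul, LinearMap.smul_apply, HahnSeries.coeff_smul, map_pow, aeval_X,
    Module.End.pow_apply, LaurentSeries.derivative_iterate_coeff, zero_add,
    Polynomial.descPochhammer_smeval_eq_descFactorial, Nat.descFactorial_self, algebraMap_smul,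
    Nat.cast_smul_eq_nsmul ℤ, ← Nat.cast_smul_eq_nsmul ℚ, smul_smul,
    inv_mul_cancel₀ hf, one_smul]

theorem divPow_induction {p : K[X] → Prop} (h_add : ∀ f g, p f → p g → p (f + g))
    (h_divPow : ∀ (a : K) (n : ℕ), p (a • divPow K n)) (f : K[X]) : p f := by
  induction f using Polynomial.induction_on' with
  | add f g hf hg => exact h_add f g hf hg
  | monomial n a =>
    have : monomial n a = (algebraMap ℚ K n.factorial * a) • divPow K n := by
      have hf : (n.factorial : ℚ) ≠ 0 := by positivity
      rw [mul_comm, mul_smul, divPow, algebraMap_smul, smul_smul, mul_inv_cancel₀ hf, one_smul,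
        smul_X_eq_monomial]
    rw [this]
    exact h_divPow _ _

theorem coeff_zero_insertionHom (a : ℕ → K) (f : K[X]) : (insertionHom a f).coeff 0 = 0 := by
  induction f using divPow_induction with
  | h_add f g hf hg => rw [map_add, coeff_add, hf, hg, add_zero]
  | h_divPow b n =>
    rw [map_smul, coeff_smul, insertionHom_divPow, finsetSum_coeff,
      Finset.sum_eq_zero, smul_zero]
    intro i hi
    rw [coeff_C_mul, coeff_divPow, if_neg, mul_zero]
    rw [Finset.mem_Icc] at hi
    omega

theorem coeff_one_insertionHom_divPow (a : ℕ → K) (n : ℕ) :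
    (insertionHom a (divPow K n)).coeff 1 = a n := by
  rw [insertionHom_divPow, finsetSum_coeff, Finset.sum_eq_single_of_mem 1 (by simp)]
  · simp [coeff_divPow]
  · intro i _ hi
    rw [coeff_C_mul, coeff_divPow, if_neg (Ne.symm hi), mul_zero]

/-- A cocycle property of insertion. On L^n/n!, differentiation lowers every divided power by one:
the term i = 1 becomes the constant a_n, and the others form the insertion of L^{n-1}/(n-1)!. -/
theorem derivative_insertionHom (a : ℕ → K) (f : K[X]) :
    derivative (insertionHom a f) =
      C ((insertionHom a f).coeff 1) + insertionHom a (derivative f) := by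
  induction f using divPow_induction with
  | h_add f g hf hg => simp only [map_add, coeff_add, hf, hg]; ring
  | h_divPow b n =>
    rw [map_smul, derivative_smul, derivative_smul, map_smul, coeff_smul, smul_eq_mul, C_mul,
      ← smul_eq_C_mul, ← smul_add, coeff_one_insertionHom_divPow, insertionHom_divPow]
    congr 1
    have : Finset.Icc 1 (n + 1) = Finset.Ico 1 (n + 2) := by
      ext; simp only [Finset.mem_Ico, Finset.mem_Icc]; omega
    rw [this, Finset.sum_Ico_eq_sum_range, show n + 2 - 1 = n + 1 by omega, derivative_sum]
    simp only [derivative_C_mul, add_comm 1, derivative_divPow_succ]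
    rw [Finset.sum_range_succ']
    simp only [zero_add, Nat.add_sub_cancel, divPow_zero, mul_one]
    rw [add_comm]
    congr 1
    cases n with
    | zero => simp
    | succ m =>
      rw [derivative_divPow_succ, insertionHom_divPow]
      have : Finset.Icc 1 (m + 1) = Finset.Ico 1 (m + 2) := by
        ext; simp only [Finset.mem_Ico, Finset.mem_Icc]; omega
      rw [this, Finset.sum_Ico_eq_sum_range, show m + 2 - 1 = m + 1 by omega]
      refine Finset.sum_congr rfl fun i _ => ?_
      rw [add_comm 1 i]
      congr 3
      omega

theorem eq_of_derivative_eq {f g : K[X]} (h : derivative f = derivative g)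
    (h0 : f.coeff 0 = g.coeff 0) : f = g := by
  have : IsAddTorsionFree K := IsAddTorsionFree.of_module_rat K
  have h1 : derivative (f - g) = 0 := by rw [derivative_sub, h, sub_self]
  rw [derivative_eq_zero] at h1
  have h2 := eq_C_of_natDegree_eq_zero h1
  rw [coeff_sub, h0, sub_self, C_0, sub_eq_zero] at h2
  exact h2

end Insertion

/-! ### Generating polynomials of tubings -/

namespace WRTree

variable {V : Type*}

theorem bStat_singleton {t : WRTree V} {r : V} {X : Finset V} (h : t.IsTubeAt r X) :
    t.bStat {X} r = 1 := by
  classical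
  unfold bStat
  rw [Finset.filter_singleton, if_pos h.1, Finset.card_singleton]

theorem IsTubeAt.eq_singleton {t : WRTree V} {r : V} {X : Finset V} (h : t.IsTubeAt r X)
    (hX : X.card = 1) : X = {r} := by
  obtain ⟨x, rfl⟩ := Finset.card_eq_one.1 hX
  rw [Finset.mem_singleton.1 h.mem]

variable [Fintype V]

/-- Induction from the children of a vertex to the vertex. -/
theorem children_induction (t : WRTree V) {p : V → Prop}
    (h : ∀ v, (∀ w ∈ t.children v, p w) → p v) (v : V) : p v := by
  induction hn : (t.descSet v).card using Nat.strong_induction_on generalizing v with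
  | _ n ih =>
  subst hn
  refine h v fun w hw => ih _ (Finset.card_lt_card ?_) w rfl
  rw [mem_children] at hw
  refine ⟨fun u hu => mem_descSet.2 ((mem_descSet.1 hu).trans hw.desc), fun h' => ?_⟩
  exact hw.not_desc (mem_descSet.1 (h' (mem_descSet.2 (Desc.refl t v))))

variable [DecidableEq V]

/-- The form (b - 1) + 2 makes the exponent of the joined tubing a visible successor of the exponent
b - 1 of the upper piece, as differentiation of divided powers requires. In the lower piece every
vertex, including its root v, is now a non-root vertex, so the full Mellin monomial appears. -/
theorem bStat_join_root_and_prod {t : WRTree V} {K : Type*} [CommRing K] (c : ℕ → ℕ → K)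
    {r v : V} {X : Finset V}
    {τ₁ τ₂ : Finset (Finset V)} (h : t.IsTubeAt r X) (hv : v ∈ X) (hne : v ≠ r)
    (h₁ : t.IsTubingOn (X ∩ t.descSet v) τ₁) (h₂ : t.IsTubingOn (X \ t.descSet v) τ₂) :
    t.bStat (insert X (τ₁ ∪ τ₂)) r = (t.bStat τ₂ r - 1) + 2 ∧
    ∏ u ∈ X.erase r, c (t.bStat (insert X (τ₁ ∪ τ₂)) u - 1) (t.weight u) =
      (∏ u ∈ X ∩ t.descSet v, c (t.bStat τ₁ u - 1) (t.weight u)) *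
        ∏ u ∈ (X \ t.descSet v).erase r, c (t.bStat τ₂ u - 1) (t.weight u) := by
  have hrD := (h.sdiff_descSet hv hne).mem
  have hrI : r ∉ X ∩ t.descSet v := fun h' =>
    (Finset.mem_sdiff.1 hrD).2 (Finset.mem_inter.1 h').2
  constructor
  · rw [bStat_join h hv hne h₁ h₂, if_pos rfl, bStat_eq_zero h₁ hrI]
    have := h₂.bStat_pos (h.sdiff_descSet hv hne)
    omega
  · have hsplit : X.erase r = (X ∩ t.descSet v) ∪ (X \ t.descSet v).erase r := by
      ext u
      have : u ∈ X ∩ t.descSet v → u ≠ r := fun h h' => hrI (by rwa [h'] at h)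
      simp only [Finset.mem_erase, Finset.mem_union, Finset.mem_sdiff, Finset.mem_inter] at this ⊢
      tauto
    have hd : Disjoint (X ∩ t.descSet v) ((X \ t.descSet v).erase r) :=
      Finset.disjoint_left.2 fun u h h' =>
        (Finset.mem_sdiff.1 (Finset.mem_of_mem_erase h')).2 (Finset.mem_inter.1 h).2
    rw [hsplit, Finset.prod_union hd]
    congr 1
    · refine Finset.prod_congr rfl fun u hu => ?_
      rw [bStat_join h hv hne h₁ h₂, if_neg (fun h' : u = r => hrI (h' ▸ hu)),
        bStat_eq_zero h₂ (u := u), zero_add, add_zero]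
      exact fun h' => (Finset.mem_sdiff.1 h').2 (Finset.mem_inter.1 hu).2
    · refine Finset.prod_congr rfl fun u hu => ?_
      rw [Finset.mem_erase] at hu
      rw [bStat_join h hv hne h₁ h₂, if_neg hu.1, bStat_eq_zero h₁ (u := u),
        zero_add, zero_add]
      exact fun h' => (Finset.mem_sdiff.1 hu.2).2 (Finset.mem_inter.1 h').2

variable {K : Type*} [CommRing K] [Algebra ℚ K]

/-- The sum over the tubings `τ` of a tube with root `r` of `c(τ) L ^ (b - 1) / (b - 1)!`, where
`b = b(r, τ)`. -/
noncomputable def tubePoly (t : WRTree V) (c : ℕ → ℕ → K) (r : V) (X : Finset V) : K[X] :=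
  ∑ τ ∈ t.tubingsOn X,
    (∏ u ∈ X.erase r, c (t.bStat τ u - 1) (t.weight u)) • divPow K (t.bStat τ r - 1)

/-- The sum over the tubings `τ` of a tube of the full Mellin monomials. -/
noncomputable def tubeCoeff (t : WRTree V) (c : ℕ → ℕ → K) (X : Finset V) : K :=
  ∑ τ ∈ t.tubingsOn X, ∏ u ∈ X, c (t.bStat τ u - 1) (t.weight u)

/-- The sum of `φ_L` over the tubings of a tube. -/
noncomputable def tubePhi (t : WRTree V) (c : ℕ → ℕ → K) (r : V) (X : Finset V) : K[X] :=
  insertionHom (fun i => c i (t.weight r)) (t.tubePoly c r X)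

/-- The linear coefficient of the insertion of L^{b-1}/(b-1)! is c_{b-1}, exactly the root factor
missing from c(τ). -/
theorem coeff_one_tubePhi {t : WRTree V} (c : ℕ → ℕ → K) {r : V} {X : Finset V} (hr : r ∈ X) :
    (t.tubePhi c r X).coeff 1 = t.tubeCoeff c X := by
  rw [tubePhi, tubePoly, map_sum, finsetSum_coeff, tubeCoeff]
  refine Finset.sum_congr rfl fun τ _ => ?_
  rw [map_smul, coeff_smul, coeff_one_insertionHom_divPow, smul_eq_mul,
    Finset.prod_erase_mul _ _ hr]

theorem derivative_tubePhi {t : WRTree V} (c : ℕ → ℕ → K) {r : V} {X : Finset V} (hr : r ∈ X) :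
    derivative (t.tubePhi c r X) = C (t.tubeCoeff c X) +
      insertionHom (fun i => c i (t.weight r)) (derivative (t.tubePoly c r X)) := by
  rw [← coeff_one_tubePhi c hr, tubePhi, derivative_insertionHom]

theorem coeff_zero_tubePhi (t : WRTree V) (c : ℕ → ℕ → K) (r : V) (X : Finset V) :
    (t.tubePhi c r X).coeff 0 = 0 :=
  coeff_zero_insertionHom _ _

theorem tubePoly_of_card_eq_one {t : WRTree V} (c : ℕ → ℕ → K) {r : V} {X : Finset V}
    (h : t.IsTubeAt r X) (hX : X.card = 1) : t.tubePoly c r X = 1 := by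
  rw [tubePoly, tubingsOn_of_card_eq_one h hX, Finset.sum_singleton, bStat_singleton h,
    h.eq_singleton hX]
  simp

/-- With at least two vertices, r is the root both of X and of the upper piece, so b ≥ 2. -/
theorem coeff_zero_tubePoly {t : WRTree V} (c : ℕ → ℕ → K) {r : V} {X : Finset V}
    (h : t.IsTubeAt r X) (hX : X.card ≠ 1) : (t.tubePoly c r X).coeff 0 = 0 := by
  rw [tubePoly, sum_tubingsOn h hX]
  simp only [finsetSum_coeff]
  refine Finset.sum_eq_zero fun v hv => Finset.sum_eq_zero fun τ₁ h₁ =>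
    Finset.sum_eq_zero fun τ₂ h₂ => ?_
  rw [Finset.mem_erase] at hv
  rw [(bStat_join_root_and_prod c h hv.2 hv.1 (mem_tubingsOn.1 h₁) (mem_tubingsOn.1 h₂)).1,
    coeff_smul, coeff_divPow, if_neg (by omega), smul_zero]

theorem derivative_tubePoly {t : WRTree V} (c : ℕ → ℕ → K) {r : V} {X : Finset V}
    (h : t.IsTubeAt r X) :
    derivative (t.tubePoly c r X) = ∑ v ∈ X.erase r,
      t.tubeCoeff c (X ∩ t.descSet v) • t.tubePoly c r (X \ t.descSet v) := by
  by_cases hX : X.card = 1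
  · rw [tubePoly_of_card_eq_one c h hX, h.eq_singleton hX]
    simp
  rw [tubePoly, sum_tubingsOn h hX]
  simp only [derivative_sum]
  refine Finset.sum_congr rfl fun v hv => ?_
  rw [tubeCoeff, tubePoly, Finset.sum_smul]
  refine Finset.sum_congr rfl fun τ₁ h₁ => ?_
  rw [Finset.smul_sum]
  refine Finset.sum_congr rfl fun τ₂ h₂ => ?_
  rw [Finset.mem_erase] at hv
  obtain ⟨e₁, e₂⟩ :=
    bStat_join_root_and_prod c h hv.2 hv.1 (mem_tubingsOn.1 h₁) (mem_tubingsOn.1 h₂)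
  rw [e₁, e₂, derivative_smul, mul_smul]
  congr 2
  exact derivative_divPow_succ _

theorem IsTubeAt.exists_child {t : WRTree V} {r u : V} {X : Finset V} (h : t.IsTubeAt r X)
    (hu : u ∈ X) (hne : u ≠ r) : ∃ v ∈ X ∩ t.children r, u ∈ X ∩ t.descSet v := by
  obtain ⟨v, hv, huv⟩ := (h.desc hu).exists_child hne
  exact ⟨v, by simp [hv, h.convex hu hv.desc huv], by simp [hu, huv]⟩

theorem derivative_tubePoly_eq {t : WRTree V} (c : ℕ → ℕ → K) {r : V} {X : Finset V}
    (h : t.IsTubeAt r X) :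
    derivative (t.tubePoly c r X) = ∑ i ∈ X ∩ t.children r, ∑ v ∈ X ∩ t.descSet i,
      t.tubeCoeff c (X ∩ t.descSet v) • t.tubePoly c r (X \ t.descSet v) := by
  rw [derivative_tubePoly c h, ← Finset.sum_biUnion]
  · refine Finset.sum_congr ?_ fun _ _ => rfl
    ext u
    simp only [Finset.mem_biUnion, Finset.mem_erase]
    constructor
    · rintro ⟨h1, h2⟩
      exact h.exists_child h2 h1
    · rintro ⟨i, hi, hu⟩
      simp only [Finset.mem_inter, mem_children, mem_descSet] at hi hu
      refine ⟨?_, hu.1⟩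
      rintro rfl
      exact hi.2.not_desc hu.2
  · intro i hi j hj hij
    refine Finset.disjoint_left.2 fun u hu hu' => hij ?_
    simp only [Finset.mem_inter, mem_children, mem_descSet, Finset.coe_inter,
      Set.mem_inter_iff, Finset.mem_coe] at hi hj hu hu'
    exact hi.2.eq_of_desc hj.2 hu.2 hu'.2

/-- The generating polynomial of the tubings of a tube factors over the children of its root. -/
theorem tubePoly_eq_prod {t : WRTree V} (c : ℕ → ℕ → K) {r : V} {X : Finset V}
    (h : t.IsTubeAt r X) :
    t.tubePoly c r X = ∏ i ∈ X ∩ t.children r, t.tubePhi c i (X ∩ t.descSet i) := by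
  induction hn : X.card using Nat.strong_induction_on generalizing X with
  | _ n ih =>
  subst hn
  by_cases hX : X.card = 1
  · rw [tubePoly_of_card_eq_one c h hX, h.eq_singleton hX, Finset.prod_eq_one]
    intro i hi
    simp only [Finset.mem_inter, Finset.mem_singleton, mem_children] at hi
    exact absurd (hi.1 ▸ Desc.refl t r) hi.2.not_desc
  refine eq_of_derivative_eq ?_ ?_
  · rw [derivative_tubePoly_eq c h, derivative_prod_finset]
    refine Finset.sum_congr rfl fun i hi => ?_
    have hi' := hi
    simp only [Finset.mem_inter, mem_children] at hi
    have hTi := h.inter_descSet hi.1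
    rw [derivative_tubePhi c hTi.mem, derivative_tubePoly c hTi,
      ← Finset.add_sum_erase _ _ hTi.mem, mul_add, map_sum, Finset.mul_sum]
    have hlt : ∀ v ∈ X, (X \ t.descSet v).card < X.card := fun v hv =>
      Finset.card_lt_card ⟨Finset.sdiff_subset, fun h' => by
        simpa [Desc.refl] using h' hv⟩
    have hne : ∀ v, t.Desc v i → v ≠ r := fun v hv h' => hi.2.not_desc (h' ▸ hv)
    have hchild : ∀ {j v}, t.IsChild j r → t.Desc v i → t.Desc j v → j = i ∧ v = i := by
      intro j v hj hv hjv
      obtain rfl := hj.eq_of_desc hi.2 (Desc.refl t j) (hjv.trans hv)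
      exact ⟨rfl, hv.antisymm hjv⟩
    have hinter : ∀ {j v}, t.IsChild j r → j ≠ i → t.Desc v i →
        (X \ t.descSet v) ∩ t.descSet j = X ∩ t.descSet j := by
      intro j v hj hji hv
      ext u
      simp only [Finset.mem_inter, Finset.mem_sdiff, mem_descSet]
      have : t.Desc u j → ¬ t.Desc u v := fun h1 h2 =>
        hji (hj.eq_of_desc hi.2 h1 (h2.trans hv))
      tauto
    -- First the cut at v = i, which removes the whole branch at i and leaves the other factors;
    -- then the cuts strictly below i.
    congr 1
    · rw [ih _ (hlt i hi.1) (h.sdiff_descSet hi.1 (hne i (Desc.refl t i))) rfl, smul_eq_C_mul,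
        mul_comm]
      congr 1
      refine Finset.prod_congr ?_ fun j hj => ?_
      · ext j
        simp only [Finset.mem_inter, Finset.mem_sdiff, Finset.mem_erase, mem_descSet,
          mem_children]
        constructor
        · rintro ⟨⟨h1, h2⟩, h3⟩
          exact ⟨fun h' => h2 (h' ▸ Desc.refl t j), h1, h3⟩
        · rintro ⟨h1, h2, h3⟩
          exact ⟨⟨h2, fun h' => h1 (hchild h3 (Desc.refl t i) h').1⟩, h3⟩
      · simp only [Finset.mem_inter, Finset.mem_erase, mem_children] at hj
        rw [hinter hj.2.2 hj.1 (Desc.refl t i)]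
    -- A cut strictly below i alters only the factor of i, which becomes the insertion of the
    -- polynomial of the smaller branch.
    · refine Finset.sum_congr rfl fun v hv => ?_
      simp only [Finset.mem_inter, Finset.mem_erase, mem_descSet] at hv
      obtain ⟨hvi, hvX, hvd⟩ := hv
      have e1 : X ∩ t.descSet i ∩ t.descSet v = X ∩ t.descSet v := by
        ext u
        simp only [Finset.mem_inter, mem_descSet]
        have : t.Desc u v → t.Desc u i := fun h' => h'.trans hvd
        tauto
      have e2 : (X \ t.descSet v) ∩ t.children r = X ∩ t.children r := by
        ext j
        simp only [Finset.mem_inter, Finset.mem_sdiff, mem_descSet, mem_children]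
        have : t.IsChild j r → ¬ t.Desc j v := fun h1 h2 => hvi (hchild h1 hvd h2).2
        tauto
      have e3 : (X \ t.descSet v) ∩ t.descSet i = (X ∩ t.descSet i) \ t.descSet v := by
        ext u
        simp only [Finset.mem_inter, Finset.mem_sdiff]
        tauto
      rw [ih _ (hlt v hvX) (h.sdiff_descSet hvX (hne v hvd)) rfl, e2,
        ← Finset.prod_erase_mul _ _ hi', e1, e3, map_smul, mul_smul_comm, tubePhi]
      congr 2
      refine Finset.prod_congr rfl fun j hj => ?_
      simp only [Finset.mem_inter, Finset.mem_erase, mem_children] at hj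
      rw [hinter hj.2.2 hj.1 hvd]
  -- The product is not empty, since X contains a child of r, and an insertion has no constant term.
  · rw [coeff_zero_tubePoly c h hX]
    obtain ⟨u, hu, hur⟩ : ∃ u ∈ X, u ≠ r := by
      by_contra hcon
      push Not at hcon
      exact hX (Finset.card_eq_one.2 ⟨r, Finset.eq_singleton_iff_unique_mem.2 ⟨h.mem, hcon⟩⟩)
    obtain ⟨v, hv, -⟩ := h.exists_child hu hur
    rw [coeff_zero_prod, Finset.prod_eq_zero hv (t.coeff_zero_tubePhi c _ _)]

theorem tubePhi_descSet (t : WRTree V) (c : ℕ → ℕ → K) (v : V) :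
    t.tubePhi c v (t.descSet v) = insertionHom (fun i => c i (t.weight v))
      (∏ i ∈ t.children v, t.tubePhi c i (t.descSet i)) := by
  have h := t.isTubeAt_univ.inter_descSet (Finset.mem_univ v)
  rw [Finset.univ_inter] at h
  have e1 : t.descSet v ∩ t.children v = t.children v := by
    ext u
    simp only [Finset.mem_inter, mem_children, mem_descSet]
    exact ⟨fun h => h.2, fun h => ⟨h.desc, h⟩⟩
  rw [tubePhi, tubePoly_eq_prod c h, e1]
  congr 1
  refine Finset.prod_congr rfl fun i hi => ?_
  rw [mem_children] at hi
  congr 1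
  ext u
  simp only [Finset.mem_inter, mem_descSet]
  exact ⟨fun h => h.2, fun h => ⟨h.trans hi.desc, h⟩⟩

theorem phi_eq_insertionHom {t : WRTree V} (c : ℕ → ℕ → K) {τ : Finset (Finset V)}
    (h : 0 < t.bStat τ t.root) :
    t.phi c τ = insertionHom (fun i => c i (t.weight t.root))
      (t.mellinMonomial c τ • divPow K (t.bStat τ t.root - 1)) := by
  rw [map_smul, insertionHom_divPow, Nat.sub_add_cancel h, smul_eq_C_mul]
  rfl

theorem bStat_root_pos {t : WRTree V} {τ : Finset (Finset V)} (h : τ ∈ t.tubings) :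
    0 < t.bStat τ t.root := by
  rw [← tubingsOn_univ, mem_tubingsOn] at h
  exact h.bStat_pos t.isTubeAt_univ

theorem sum_phi (t : WRTree V) (c : ℕ → ℕ → K) :
    ∑ τ ∈ t.tubings, t.phi c τ = t.tubePhi c t.root Finset.univ := by
  rw [tubePhi, tubePoly, map_sum, tubingsOn_univ]
  exact Finset.sum_congr rfl fun τ hτ => phi_eq_insertionHom c (bStat_root_pos hτ)

theorem coeff_one_sum_phi (t : WRTree V) (c : ℕ → ℕ → K) :
    (∑ τ ∈ t.tubings, t.phi c τ).coeff 1 =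
      ∑ τ ∈ t.tubings, ∏ v, c (t.bStat τ v - 1) (t.weight v) := by
  rw [sum_phi, coeff_one_tubePhi c (Finset.mem_univ _), tubeCoeff, tubingsOn_univ]

/-- A product over the descendants of a vertex, split along its children. -/
@[to_additive]
theorem prod_descSet {M : Type*} [CommMonoid M] (t : WRTree V) (g : V → M) (v : V) :
    ∏ u ∈ t.descSet v, g u = g v * ∏ w ∈ t.children v, ∏ u ∈ t.descSet w, g u := by
  rw [← Finset.mul_prod_erase _ _ (mem_descSet.2 (Desc.refl t v)), ← Finset.prod_biUnion]
  · congr 1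
    refine Finset.prod_congr ?_ fun _ _ => rfl
    ext u
    simp only [Finset.mem_biUnion, Finset.mem_erase, mem_descSet, mem_children]
    constructor
    · rintro ⟨h1, h2⟩
      exact h2.exists_child h1
    · rintro ⟨i, hi, hu⟩
      refine ⟨?_, hu.trans hi.desc⟩
      rintro rfl
      exact hi.not_desc hu
  · intro i hi j hj hij
    refine Finset.disjoint_left.2 fun u hu hu' => hij ?_
    simp only [mem_descSet, Finset.mem_coe, mem_children] at hi hj hu hu'
    exact hi.eq_of_desc hj hu hu'

end WRTree

/-! ### Isomorphisms as covers, and plane trees -/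

namespace WRTree

variable {V V' : Type*}

/-- A map of weighted rooted trees onto the subtree at `v` that is bijective on children. -/
structure IsCover (t' : WRTree V') (t : WRTree V) (v : V) (ι : V' → V) : Prop where
  root : ι t'.root = v
  weight : ∀ u, t.weight (ι u) = t'.weight u
  bijOn : ∀ u, Set.BijOn ι {w | t'.IsChild w u} {w | t.IsChild w (ι u)}

theorem IsCover.self {t' : WRTree V'} {t : WRTree V} {v : V} {ι : V' → V}
    (h : IsCover t' t v ι) : IsCover t' t (ι t'.root) ι :=
  ⟨rfl, h.weight, h.bijOn⟩

/-- An isomorphism only preserves undirected edges and the root; orientation follows by induction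
from the root. If the image of the parent of w were a child of the image of w, then w would be its
own grandparent. -/
theorem Iso.map_parent {t' : WRTree V'} {t : WRTree V} (e : Iso t' t) (w : V') :
    e.1 (t'.parent w) = t.parent (e.1 w) := by
  refine t'.parent_induction (p := fun w => e.1 (t'.parent w) = t.parent (e.1 w)) ?_ ?_ w
  · rw [t'.parent_root, e.2.1, t.parent_root]
  · intro w hw ih
    have h : t.graph.Adj (e.1 w) (e.1 (t'.parent w)) :=
      e.1.map_rel_iff.2 ((t'.graph_adj _ _).2 (Or.inl ⟨hw, rfl⟩))
    rcases (t.graph_adj _ _).1 h with h | h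
    · exact h.2.symm
    · exfalso
      have h1 : w = t'.parent (t'.parent w) := e.1.injective (h.2.symm.trans ih.symm)
      have h2 := t'.depth_of_ne_root hw
      have h3 := t'.depth_parent_le (t'.parent w)
      rw [← h1] at h3
      omega

theorem Iso.isChild_iff {t' : WRTree V'} {t : WRTree V} (e : Iso t' t) (w u : V') :
    t.IsChild (e.1 w) (e.1 u) ↔ t'.IsChild w u := by
  have h : e.1 w = t.root ↔ w = t'.root := by rw [← e.1.injective.eq_iff, e.2.1]
  rw [IsChild, IsChild, ← e.map_parent, e.1.injective.eq_iff, Ne, Ne, h]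

theorem Iso.isCover {t' : WRTree V'} {t : WRTree V} (e : Iso t' t) :
    IsCover t' t t.root e.1 where
  root := e.2.1
  weight := e.2.2
  bijOn u := by
    refine ⟨fun w hw => (e.isChild_iff w u).2 hw, e.1.injective.injOn, fun c hc => ?_⟩
    refine ⟨e.1.symm c, ?_, e.1.apply_symm_apply c⟩
    rw [Set.mem_ofPred_eq, ← e.isChild_iff, e.1.apply_symm_apply]
    exact hc

theorem IsCover.injective {t' : WRTree V'} {t : WRTree V} {ι : V' → V}
    (h : IsCover t' t t.root ι) : Function.Injective ι := by
  have hne : ∀ u, u ≠ t'.root → t.IsChild (ι u) (ι (t'.parent u)) := fun u hu =>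
    (h.bijOn (t'.parent u)).mapsTo ⟨hu, rfl⟩
  intro u
  refine t'.parent_induction (p := fun u => ∀ u', ι u = ι u' → u = u') ?_ ?_ u
  · intro u' hu'
    by_contra hcon
    exact (hne u' (Ne.symm hcon)).1 (hu' ▸ h.root)
  · intro u hu ih u' huu'
    have hu' : u' ≠ t'.root := by
      rintro rfl
      exact (hne u hu).1 (huu'.trans h.root)
    have hp : t'.parent u = t'.parent u' := by
      refine ih _ ?_
      rw [← (hne u hu).2, ← (hne u' hu').2, huu']
    exact (h.bijOn (t'.parent u)).injOn ⟨hu, rfl⟩ ⟨hu', hp.symm⟩ huu'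

theorem IsCover.surjective {t' : WRTree V'} {t : WRTree V} {ι : V' → V}
    (h : IsCover t' t t.root ι) : Function.Surjective ι := by
  intro w
  refine t.parent_induction (p := fun w => ∃ u, ι u = w) ⟨_, h.root⟩ ?_ w
  rintro w hw ⟨u, hu⟩
  obtain ⟨u', -, hu'⟩ := (h.bijOn u).surjOn (show t.IsChild w (ι u) from ⟨hw, hu.symm⟩)
  exact ⟨u', hu'⟩

/-- Isomorphisms are the maps onto the whole tree that are bijective on children. -/
noncomputable def isoEquivCover (t' : WRTree V') (t : WRTree V) :
    Iso t' t ≃ {ι : V' → V // IsCover t' t t.root ι} where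
  toFun e := ⟨e.1, e.isCover⟩
  invFun ι := ⟨⟨Equiv.ofBijective ι.1 ⟨ι.2.injective, ι.2.surjective⟩, by
    intro a b
    have key : ∀ a b, t.IsChild (ι.1 a) (ι.1 b) ↔ t'.IsChild a b := by
      intro a b
      refine ⟨fun hab => ?_, fun hab => (ι.2.bijOn b).mapsTo hab⟩
      obtain ⟨a', ha', haa'⟩ := (ι.2.bijOn b).surjOn hab
      rwa [← ι.2.injective haa']
    rw [graph_adj, graph_adj, ← key, ← key]
    rfl⟩, ι.2.root, ι.2.weight⟩
  left_inv e := by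
    apply Subtype.ext
    ext u
    rfl
  right_inv ι := rfl

end WRTree

/-- Plane rooted trees with weights in `ℤ_{≥ 1}`: the children of every vertex are ordered. -/
inductive PTree : Type
  | node (k : ℕ+) (r : ℕ) (f : Fin r → PTree) : PTree

namespace PTree

/-- The vertices of a plane tree. -/
inductive Vert : PTree → Type
  | root (P : PTree) : Vert P
  | child {k : ℕ+} {r : ℕ} {f : Fin r → PTree} (i : Fin r) (u : Vert (f i)) : Vert (node k r f)

/-- The weight of the root. -/
def label : PTree → ℕ+
  | node k _ _ => k

/-- The weight of a vertex. -/
def Vert.weight : {P : PTree} → Vert P → ℕ+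
  | P, .root _ => P.label
  | _, .child _ u => u.weight

/-- The parent of a vertex, if it is not the root. -/
def Vert.up : {P : PTree} → Vert P → Option (Vert P)
  | _, .root _ => none
  | _, .child i u => some (match u.up with
    | none => .root _
    | some u' => .child i u')

variable {k : ℕ+} {r : ℕ} {f : Fin r → PTree}

theorem Vert.up_eq_none_iff {P : PTree} (v : Vert P) : v.up = none ↔ v = .root P := by
  cases v <;> simp [Vert.up]

theorem Vert.up_child_eq_some_root {i : Fin r} {u : Vert (f i)} :
    (Vert.child (k := k) i u).up = some (.root _) ↔ u = .root (f i) := by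
  rw [← up_eq_none_iff, Vert.up]
  rcases u.up with _ | u' <;> simp

/-- Equality in the sigma type avoids casts between the vertex types of different branches. -/
theorem Vert.up_child_eq_some_child {i j : Fin r} {u : Vert (f i)} {u' : Vert (f j)} :
    (Vert.child (k := k) i u).up = some (.child j u') ↔
      ∃ w, u.up = some w ∧ (⟨i, w⟩ : Σ i, Vert (f i)) = ⟨j, u'⟩ := by
  rw [Vert.up]
  rcases u.up with _ | w <;> simp

/-- Inside a branch the walk stalls at the root of the branch, whereas in the whole tree it moves
on, so the number of steps is rebuilt by an inner induction. -/
theorem iterate_up_eq_root (P : PTree) (v : Vert P) :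
    ∃ n : ℕ, (fun v : Vert P => v.up.getD (.root P))^[n] v = .root P := by
  induction v with
  | root P => exact ⟨0, rfl⟩
  | @child k r f i u ih =>
    obtain ⟨n, hn⟩ := ih
    induction n generalizing u with
    | zero =>
      refine ⟨1, ?_⟩
      have h : u = .root _ := hn
      rw [Function.iterate_one, Vert.up_child_eq_some_root.2 h]
      rfl
    | succ n ihn =>
      rcases h : u.up with _ | u'
      · refine ⟨1, ?_⟩
        rw [Function.iterate_one, Vert.up_child_eq_some_root.2 ((Vert.up_eq_none_iff u).1 h)]
        rfl
      · rw [Function.iterate_succ_apply, h] at hn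
        obtain ⟨m, hm⟩ := ihn u' hn
        refine ⟨m + 1, ?_⟩
        rw [Function.iterate_succ_apply, Vert.up_child_eq_some_child.2 ⟨u', h, rfl⟩]
        exact hm

/-- The underlying weighted rooted tree of a plane tree. -/
def toTree (P : PTree) : WRTree (Vert P) where
  root := .root P
  parent v := v.up.getD (.root P)
  parent_root := rfl
  reaches_root := iterate_up_eq_root P
  weight := Vert.weight

theorem isChild_toTree {P : PTree} {w v : Vert P} :
    P.toTree.IsChild w v ↔ w.up = some v := by
  change w ≠ .root P ∧ w.up.getD (.root P) = v ↔ _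
  rw [Ne, ← Vert.up_eq_none_iff]
  rcases w.up with _ | u <;> simp

theorem not_isChild_root {P : PTree} {v : Vert P} : ¬ P.toTree.IsChild (.root P) v :=
  fun h => h.1 rfl

theorem isChild_child_root {i : Fin r} {u : Vert (f i)} :
    (node k r f).toTree.IsChild (.child i u) (.root _) ↔ u = .root (f i) := by
  rw [isChild_toTree, Vert.up_child_eq_some_root]

theorem isChild_child_child {i j : Fin r} {u : Vert (f i)} {u' : Vert (f j)} :
    (node k r f).toTree.IsChild (.child i u) (.child j u') ↔
      ∃ w, (f i).toTree.IsChild u w ∧ (⟨i, w⟩ : Σ i, Vert (f i)) = ⟨j, u'⟩ := by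
  rw [isChild_toTree, Vert.up_child_eq_some_child]
  simp only [isChild_toTree]

end PTree

/-! ### Counting the plane structures of a tree -/

namespace WRTree

open PTree

variable {V : Type*} {k : ℕ+} {r : ℕ} {f : Fin r → PTree}

theorem isCover_node_iff {t : WRTree V} {v : V} {ι : Vert (node k r f) → V} :
    IsCover (node k r f).toTree t v ι ↔
      ι (.root _) = v ∧ t.weight v = k ∧
        Set.BijOn (fun i => ι (.child i (.root (f i)))) Set.univ {w | t.IsChild w v} ∧
          ∀ i, IsCover (f i).toTree t (ι (.child i (.root (f i)))) fun u => ι (.child i u) := by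
  constructor
  · intro h
    obtain rfl : ι (.root _) = v := h.root
    have h0 := h.bijOn (.root _)
    refine ⟨rfl, h.weight (.root _), ⟨?_, ?_, ?_⟩, fun i => ⟨rfl, fun u => h.weight (.child i u),
      fun u => ?_⟩⟩
    · exact fun i _ => h0.mapsTo (isChild_child_root.2 rfl)
    · intro i _ j _ hij
      have := h0.injOn (isChild_child_root.2 rfl) (isChild_child_root.2 rfl) hij
      injection this
    · intro w hw
      obtain ⟨x, hx, rfl⟩ := h0.surjOn hw
      cases x with
      | root => exact absurd hx not_isChild_root
      | child i u =>
        obtain rfl := isChild_child_root.1 hx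
        exact ⟨i, trivial, rfl⟩
    · have hu := h.bijOn (.child i u)
      refine ⟨?_, ?_, ?_⟩
      · exact fun w hw => hu.mapsTo (isChild_child_child.2 ⟨u, hw, rfl⟩)
      · intro w hw w' hw' hww
        have := hu.injOn (isChild_child_child.2 ⟨u, hw, rfl⟩)
          (isChild_child_child.2 ⟨u, hw', rfl⟩) hww
        simpa using this
      · intro w hw
        obtain ⟨x, hx, rfl⟩ := hu.surjOn hw
        cases x with
        | root => exact absurd hx not_isChild_root
        | child j u' =>
          obtain ⟨w, hw, e⟩ := isChild_child_child.1 hx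
          cases e
          exact ⟨u', hw, rfl⟩
  · rintro ⟨rfl, hk, hb, hc⟩
    refine ⟨rfl, fun u => ?_, fun u => ?_⟩
    · cases u with
      | root => exact hk
      | child i u => exact (hc i).weight u
    · cases u with
      | root =>
        refine ⟨?_, ?_, ?_⟩
        · intro w hw
          cases w with
          | root => exact absurd hw not_isChild_root
          | child i u =>
            obtain rfl := isChild_child_root.1 hw
            exact hb.mapsTo trivial
        · intro w hw w' hw' hww
          cases w with
          | root => exact absurd hw not_isChild_root
          | child i u =>
            cases w' with
            | root => exact absurd hw' not_isChild_root
            | child i' u' =>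
              obtain rfl := isChild_child_root.1 hw
              obtain rfl := isChild_child_root.1 hw'
              obtain rfl : i = i' := hb.injOn trivial trivial hww
              rfl
        · intro w hw
          obtain ⟨i, -, rfl⟩ := hb.surjOn hw
          exact ⟨.child i (.root _), isChild_child_root.2 rfl, rfl⟩
      | child i u =>
        have hu := (hc i).bijOn u
        refine ⟨?_, ?_, ?_⟩
        · intro w hw
          cases w with
          | root => exact absurd hw not_isChild_root
          | child j u' =>
            obtain ⟨w, hw, e⟩ := isChild_child_child.1 hw
            cases e
            exact hu.mapsTo hw
        · intro w hw w' hw' hww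
          cases w with
          | root => exact absurd hw not_isChild_root
          | child j u₁ =>
            cases w' with
            | root => exact absurd hw' not_isChild_root
            | child j' u₁' =>
              obtain ⟨w, hw, e⟩ := isChild_child_child.1 hw
              cases e
              obtain ⟨w', hw', e⟩ := isChild_child_child.1 hw'
              cases e
              rw [hu.injOn hw hw' hww]
        · intro w hw
          obtain ⟨x, hx, rfl⟩ := hu.surjOn hw
          exact ⟨.child i x, isChild_child_child.2 ⟨u, hx, rfl⟩, rfl⟩

/-- The maps that exhibit the subtree at `v` as the plane tree `P`. -/
def Cover (t : WRTree V) (P : PTree) (v : V) : Type _ :=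
  {ι : Vert P → V // IsCover P.toTree t v ι}

/-- An ordering of the children of `v`. -/
def ChildOrder (t : WRTree V) (v : V) : Type _ :=
  Σ r : ℕ, {g : Fin r → V // Set.BijOn g Set.univ {w | t.IsChild w v}}

/-- A map defined on the root and on the branches of a plane tree. -/
def glue (v : V) (ι : ∀ i, Vert (f i) → V) : Vert (node k r f) → V
  | .root _ => v
  | .child i u => ι i u

/-- Exhibiting the subtree at `v` as a plane tree amounts to ordering the children of `v` and
exhibiting the subtrees at the children as plane trees. -/
def coverEquiv (t : WRTree V) (v : V) :
    (Σ P, t.Cover P v) ≃ Σ g : t.ChildOrder v, ∀ i, Σ P, t.Cover P (g.2.1 i) where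
  toFun
    | ⟨node _ r f, ι⟩ =>
      ⟨⟨r, fun i => ι.1 (.child i (.root (f i))), (isCover_node_iff.1 ι.2).2.2.1⟩,
        fun i => ⟨f i, fun u => ι.1 (.child i u), (isCover_node_iff.1 ι.2).2.2.2 i⟩⟩
  invFun
    | ⟨⟨r, g⟩, F⟩ => ⟨node (t.weight v) r fun i => (F i).1, glue v fun i => (F i).2.1,
      isCover_node_iff.2 ⟨rfl, rfl, by
        have : (fun i => glue (k := t.weight v) v (fun i => (F i).2.1) (.child i (.root (F i).1))) =
          g.1 := funext fun i => (F i).2.2.root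
        rw [this]
        exact g.2, fun i => (F i).2.2.self⟩⟩
  left_inv := by
    rintro ⟨⟨k, r, f⟩, ι, hι⟩
    have h := isCover_node_iff.1 hι
    obtain rfl := h.2.1
    refine Sigma.ext rfl (heq_of_eq (Subtype.ext (funext fun u => ?_)))
    cases u with
    | root => exact h.1.symm
    | child i u => rfl
  right_inv := by
    rintro ⟨⟨r, g, hg⟩, F⟩
    -- The type of F depends on g. Separating its data G from the proofs allows g to be replaced by
    -- the root values of G.
    obtain ⟨G, hG, rfl⟩ : ∃ (G : Fin r → Σ P, Vert P → V)
        (hG : ∀ i, IsCover (G i).1.toTree t (g i) (G i).2), F = fun i => ⟨(G i).1, (G i).2, hG i⟩ :=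
      ⟨fun i => ⟨(F i).1, (F i).2.1⟩, fun i => (F i).2.2, rfl⟩
    obtain rfl : g = fun i => (G i).2 (.root _) := funext fun i => (hG i).root.symm
    rfl

/-- An ordering of the children as an equivalence. -/
noncomputable def ChildOrder.equiv [Fintype V] {t : WRTree V} {v : V} (g : t.ChildOrder v) :
    Fin g.1 ≃ t.children v :=
  Equiv.ofBijective (fun i => ⟨g.2.1 i, mem_children.2 (g.2.2.mapsTo trivial)⟩)
    ⟨fun _ _ h => g.2.2.injOn trivial trivial (congrArg Subtype.val h), fun ⟨w, hw⟩ => by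
      obtain ⟨i, -, hi⟩ := g.2.2.surjOn (mem_children.1 hw)
      exact ⟨i, Subtype.ext hi⟩⟩

theorem ChildOrder.fst_eq [Fintype V] {t : WRTree V} {v : V} (g : t.ChildOrder v) :
    g.1 = (t.children v).card := by
  rw [← Fintype.card_coe, ← Fintype.card_congr g.equiv, Fintype.card_fin]

@[to_additive]
theorem ChildOrder.prod_eq [Fintype V] {M : Type*} [CommMonoid M] {t : WRTree V} {v : V}
    (g : t.ChildOrder v) (F : V → M) : ∏ i, F (g.2.1 i) = ∏ w ∈ t.children v, F w := by
  rw [← Finset.prod_coe_sort (t.children v)]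
  exact Fintype.prod_equiv g.equiv _ _ fun _ => rfl

theorem card_childOrder [Fintype V] [DecidableEq V] (t : WRTree V) (v : V) :
    Nat.card (t.ChildOrder v) = (t.outDegree v).factorial := by
  have hcard : Fintype.card (t.children v) = t.outDegree v := by
    rw [Fintype.card_coe, card_children]
  have hr : ∀ g : t.ChildOrder v, g.1 = t.outDegree v := fun g => by
    rw [g.fst_eq, card_children]
  generalize t.outDegree v = n at hcard hr
  have e : (Fin n ≃ t.children v) ≃ t.ChildOrder v := by
    refine Equiv.ofBijective (fun e => ⟨n, fun i => e i, ?_, ?_, ?_⟩) ⟨?_, ?_⟩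
    · exact fun i _ => mem_children.1 (e i).2
    · exact fun i _ j _ h => e.injective (Subtype.ext h)
    · exact fun w hw => ⟨e.symm ⟨w, mem_children.2 hw⟩, trivial, by simp⟩
    · intro e e' h
      have h' := eq_of_heq (Sigma.mk.inj h).2
      ext i
      exact congrFun (congrArg Subtype.val h') i
    · intro g
      obtain rfl := hr g
      exact ⟨g.equiv, rfl⟩
  rw [← Nat.card_congr e, Nat.card_eq_fintype_card,
    Fintype.card_equiv (Fintype.equivFinOfCardEq hcard).symm, Fintype.card_fin]

theorem card_sigma_cover_eq [Fintype V] [DecidableEq V] (t : WRTree V) (v : V) :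
    Nat.card (Σ P, t.Cover P v) =
      (t.outDegree v).factorial * ∏ w ∈ t.children v, Nat.card (Σ P, t.Cover P w) := by
  -- Reindexing by the children makes the fibre independent of the ordering g, so the sigma type
  -- becomes a product.
  have e : ∀ g : t.ChildOrder v, (∀ i, Σ P, t.Cover P (g.2.1 i)) ≃
      ∀ w : t.children v, Σ P, t.Cover P w := fun g =>
    Equiv.piCongrLeft (fun w : t.children v => Σ P, t.Cover P w) g.equiv
  rw [Nat.card_congr (t.coverEquiv v), Nat.card_congr (Equiv.sigmaCongrRight e),
    Nat.card_congr (Equiv.sigmaEquivProd _ _), Nat.card_prod, card_childOrder, Nat.card_pi,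
    Finset.prod_coe_sort (t.children v) fun w => Nat.card (Σ P, t.Cover P w)]

/-- The number of ways to exhibit the subtree at `v` as a plane tree. -/
theorem card_sigma_cover [Fintype V] [DecidableEq V] (t : WRTree V) (v : V) :
    Nat.card (Σ P, t.Cover P v) = ∏ u ∈ t.descSet v, (t.outDegree u).factorial := by
  refine t.children_induction (p := fun v => Nat.card (Σ P, t.Cover P v) =
    ∏ u ∈ t.descSet v, (t.outDegree u).factorial) (fun v ih => ?_) v
  rw [card_sigma_cover_eq, prod_descSet, Finset.prod_congr rfl ih]

end WRTree

/-! ### Evaluating plane trees through covers -/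

namespace WRTree

variable {V V' V'' : Type*}

/-- The inverse of an isomorphism. -/
def Iso.symm {t : WRTree V} {t' : WRTree V'} (e : Iso t t') : Iso t' t :=
  ⟨e.1.symm, e.1.injective ((e.1.apply_symm_apply _).trans e.2.1.symm), fun v =>
    (e.2.2 (e.1.symm v)).symm.trans (congrArg t'.weight (e.1.apply_symm_apply v))⟩

/-- The composition of isomorphisms. -/
def Iso.trans {t : WRTree V} {t' : WRTree V'} {t'' : WRTree V''} (e : Iso t t')
    (e' : Iso t' t'') : Iso t t'' :=
  ⟨e.1.trans e'.1, (congrArg e'.1 e.2.1).trans e'.2.1, fun v =>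
    (e'.2.2 (e.1 v)).trans (e.2.2 v)⟩

/-- Composition with a fixed isomorphism. -/
def Iso.equivAut {t : WRTree V} {t' : WRTree V'} (e : Iso t t') : Iso t t' ≃ Aut t' where
  toFun f := e.symm.trans f
  invFun a := e.trans a
  left_inv f := Subtype.ext (RelIso.ext fun v => congrArg f.1 (e.1.symm_apply_apply v))
  right_inv a := Subtype.ext (RelIso.ext fun v => congrArg a.1 (e.1.apply_symm_apply v))

/-- The tree obtained by renaming the vertices. -/
def relabel (t : WRTree V) (e : V ≃ V') : WRTree V' where
  root := e t.root
  parent v := e (t.parent (e.symm v))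
  parent_root := by rw [e.symm_apply_apply, t.parent_root]
  reaches_root v := by
    obtain ⟨n, hn⟩ := t.reaches_root (e.symm v)
    refine ⟨n, ?_⟩
    have h : Function.Semiconj e t.parent fun v => e (t.parent (e.symm v)) := fun u => by
      change _ = e (t.parent (e.symm (e u)))
      rw [e.symm_apply_apply]
    rw [← hn, h.iterate_right n, e.apply_symm_apply]
  weight v := t.weight (e.symm v)

/-- Renaming the vertices is an isomorphism. -/
def relabelIso (t : WRTree V) (e : V ≃ V') : Iso t (t.relabel e) :=
  ⟨⟨e, by
    intro a b
    rw [graph_adj, graph_adj]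
    simp only [IsChild, relabel, e.symm_apply_apply, e.injective.eq_iff, Ne]⟩, rfl, fun v => by
    change t.weight (e.symm (e v)) = _
    rw [e.symm_apply_apply]⟩

end WRTree

namespace PTree

theorem finite_vert (P : PTree) : Finite (Vert P) := by
  induction P with
  | node k r f ih =>
  refine Finite.of_surjective
    (fun x : Option (Σ i, Vert (f i)) => match x with
      | none => (.root _ : Vert (node k r f))
      | some ⟨i, u⟩ => .child i u) fun v => ?_
  cases v with
  | root => exact ⟨none, rfl⟩
  | child i u => exact ⟨some ⟨i, u⟩, rfl⟩

/-- The sum of the weights of the vertices. -/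
def weight : PTree → ℕ
  | node k _ f => k + ∑ i, (f i).weight

variable {K : Type*} [CommRing K] [Algebra ℚ K]

/-- The product over the vertices `v` of the binomial coefficients of `1 + s w(v)` over `od v`. -/
noncomputable def coef (s : K) : PTree → K
  | node k r f => ((r.factorial : ℚ)⁻¹ • (descPochhammer K r).eval (1 + s * ((k : ℕ) : K))) *
      ∏ i, (f i).coef s

/-- The value on a plane tree of the map that turns grafting into insertion. -/
noncomputable def phi (c : ℕ → ℕ → K) : PTree → K[X]
  | node k _ f => insertionHom (fun i => c i k) (∏ i, (f i).phi c)

end PTree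

namespace WRTree

open PTree

section Evaluate

variable {V : Type*} [Fintype V] [DecidableEq V]
variable {K : Type*} [CommRing K] [Algebra ℚ K]

theorem Cover.weight_eq {t : WRTree V} {P : PTree} {v : V} (ι : t.Cover P v) :
    P.weight = ∑ u ∈ t.descSet v, (t.weight u : ℕ) := by
  induction P generalizing v with
  | node k r f ih =>
  obtain ⟨-, hk, hb, hc⟩ := isCover_node_iff.1 ι.2
  have h := fun i => ih i ⟨_, hc i⟩
  rw [PTree.weight, sum_descSet, hk, Finset.sum_congr rfl fun i _ => h i]
  congr 1
  exact ChildOrder.sum_eq ⟨r, _, hb⟩ fun w => ∑ u ∈ t.descSet w, (t.weight u : ℕ)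

theorem Cover.coef_eq {t : WRTree V} {P : PTree} {v : V} (ι : t.Cover P v) (s : K) :
    P.coef s = ∏ u ∈ t.descSet v, (((t.outDegree u).factorial : ℚ)⁻¹ •
      (descPochhammer K (t.outDegree u)).eval (1 + s * ((t.weight u : ℕ) : K))) := by
  induction P generalizing v with
  | node k r f ih =>
  obtain ⟨-, hk, hb, hc⟩ := isCover_node_iff.1 ι.2
  have h := fun i => ih i ⟨_, hc i⟩
  have hr : r = t.outDegree v := by
    rw [← card_children]
    exact ChildOrder.fst_eq ⟨r, _, hb⟩
  rw [PTree.coef, prod_descSet, hk, Finset.prod_congr rfl fun i _ => h i, ← hr]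
  congr 1
  exact ChildOrder.prod_eq ⟨r, _, hb⟩ fun w => ∏ u ∈ t.descSet w,
    (((t.outDegree u).factorial : ℚ)⁻¹ •
      (descPochhammer K (t.outDegree u)).eval (1 + s * ((t.weight u : ℕ) : K)))

theorem Cover.phi_eq {t : WRTree V} {P : PTree} {v : V} (ι : t.Cover P v) (c : ℕ → ℕ → K) :
    P.phi c = t.tubePhi c v (t.descSet v) := by
  induction P generalizing v with
  | node k r f ih =>
  obtain ⟨-, hk, hb, hc⟩ := isCover_node_iff.1 ι.2
  have h := fun i => ih i ⟨_, hc i⟩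
  rw [PTree.phi, tubePhi_descSet, hk, Finset.prod_congr rfl fun i _ => h i]
  congr 1
  exact ChildOrder.prod_eq ⟨r, _, hb⟩ fun w => t.tubePhi c w (t.descSet w)

/-- The number of plane embeddings of a tree. -/
theorem card_plane_mul_card_aut (t : WRTree V) :
    Nat.card {P : PTree // Nonempty (Iso P.toTree t)} * Nat.card t.Aut =
      ∏ u, (t.outDegree u).factorial := by
  -- A cover at the root is an isomorphism, so restricting to P isomorphic to t loses nothing. Each
  -- fibre is then in bijection with Aut t.
  have e : (Σ P : {P : PTree // Nonempty (Iso P.toTree t)}, t.Cover P.1 t.root) ≃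
      Σ P, t.Cover P t.root :=
    Equiv.ofBijective (fun x => ⟨x.1.1, x.2⟩)
      ⟨fun ⟨⟨P, hP⟩, x⟩ ⟨⟨P', hP'⟩, x'⟩ h => by
        obtain ⟨rfl, h'⟩ := Sigma.mk.inj h
        obtain rfl := eq_of_heq h'
        rfl,
      fun ⟨P, x⟩ => ⟨⟨⟨P, ⟨(isoEquivCover P.toTree t).symm x⟩⟩, x⟩, rfl⟩⟩
  have e' : ∀ P : {P : PTree // Nonempty (Iso P.toTree t)}, t.Cover P.1 t.root ≃ t.Aut :=
    fun P => (isoEquivCover P.1.toTree t).symm.trans P.2.some.equivAut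
  rw [← descSet_root, ← card_sigma_cover, ← Nat.card_congr e,
    Nat.card_congr (Equiv.sigmaCongrRight e'), Nat.card_congr (Equiv.sigmaEquivProd _ _),
    Nat.card_prod]

theorem Iso.weight_eq {t : WRTree V} {P : PTree} (e : Iso P.toTree t) :
    P.weight = t.totalWeight := by
  rw [Cover.weight_eq (isoEquivCover _ _ e), descSet_root, totalWeight]

theorem Iso.phi_eq {t : WRTree V} {P : PTree} (e : Iso P.toTree t) (c : ℕ → ℕ → K) :
    P.phi c = ∑ τ ∈ t.tubings, t.phi c τ := by
  rw [Cover.phi_eq (isoEquivCover _ _ e), descSet_root, sum_phi]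

theorem Iso.coef_eq {t : WRTree V} {P : PTree} (e : Iso P.toTree t) (s : K) :
    (Nat.card {P : PTree // Nonempty (Iso P.toTree t)} : ℚ) • P.coef s = t.treeFactor s := by
  have h := t.card_plane_mul_card_aut
  -- A product of factorials is nonzero, so neither factor in the count can be zero.
  have hA : (Nat.card t.Aut : ℚ) ≠ 0 := by
    intro h0
    rw [Nat.cast_eq_zero] at h0
    rw [h0, mul_zero] at h
    exact (Finset.prod_ne_zero_iff.2 fun u _ => Nat.factorial_ne_zero _) h.symm
  have hq : (Nat.card {P : PTree // Nonempty (Iso P.toTree t)} : ℚ) * Nat.card t.Aut =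
      ∏ u, ((t.outDegree u).factorial : ℚ) := by exact_mod_cast h
  have hP : (∏ u, ((t.outDegree u).factorial : ℚ)) ≠ 0 :=
    Finset.prod_ne_zero_iff.2 fun u _ => Nat.cast_ne_zero.2 (Nat.factorial_ne_zero _)
  rw [Cover.coef_eq (isoEquivCover _ _ e), descSet_root, treeFactor, Finset.prod_smul, smul_smul]
  congr 1
  rw [Finset.prod_inv_distrib, ← hq]
  rw [← hq] at hP
  field_simp [left_ne_zero_of_mul hP]

end Evaluate

end WRTree

namespace PTree

theorem weight_pos (P : PTree) : 0 < P.weight := by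
  obtain ⟨k, r, f⟩ := P
  have := k.pos
  rw [weight]
  omega

/-- Bounds the number of branches by their weight, matching the truncation r ≤ n in `seriesPow`. -/
theorem le_sum_weight {r : ℕ} (f : Fin r → PTree) : r ≤ ∑ i, (f i).weight := by
  calc r = ∑ _i : Fin r, 1 := by simp
    _ ≤ _ := Finset.sum_le_sum fun i _ => (f i).weight_pos

/-- The root has weight at least 1, so the branches fall under the previous bound, and root weight
and arity are bounded. -/
theorem finite_weight_le (n : ℕ) : {P : PTree | P.weight ≤ n}.Finite := by
  induction n with
  | zero =>
    convert Set.finite_empty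
    ext ⟨k, r, f⟩
    have hk := k.pos
    refine ⟨fun h => ?_, fun h => h.elim⟩
    change (k : ℕ) + ∑ i, (f i).weight ≤ 0 at h
    omega
  | succ n ih =>
    have h1 : ∀ r, {f : Fin r → PTree | ∀ i, (f i).weight ≤ n}.Finite := fun r => by
      have := Set.Finite.pi' (ι := Fin r) (t := fun _ => {P : PTree | P.weight ≤ n}) fun _ => ih
      exact this
    refine (Set.Finite.biUnion (Set.finite_Iic n.succPNat) fun k _ =>
      Set.Finite.biUnion (Set.finite_Iic n) fun r _ => (h1 r).image (node k r)).subset ?_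
    rintro ⟨k, r, f⟩ hP
    change (k : ℕ) + ∑ i, (f i).weight ≤ n + 1 at hP
    have hk := k.pos
    have hf : ∀ i, (f i).weight ≤ ∑ i, (f i).weight := fun i =>
      Finset.single_le_sum (f := fun i => (f i).weight) (fun _ _ => Nat.zero_le _)
        (Finset.mem_univ i)
    have hr := le_sum_weight f
    simp only [Set.mem_iUnion, Set.mem_Iic, Set.mem_image]
    refine ⟨k, ?_, r, by omega, f, fun i => ?_, rfl⟩
    · rw [← PNat.coe_le_coe, Nat.succPNat_coe]
      omega
    · have := hf i
      omega

theorem finite_weight_eq (n : ℕ) : {P : PTree | P.weight = n}.Finite :=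
  (finite_weight_le n).subset fun _ h => le_of_eq h

/-- The plane trees of weight `n`. -/
noncomputable def ofWeight (n : ℕ) : Finset PTree := (finite_weight_eq n).toFinset

@[simp]
theorem mem_ofWeight {n : ℕ} {P : PTree} : P ∈ ofWeight n ↔ P.weight = n := by
  simp [ofWeight]

end PTree

/-! ### Regrouping plane trees by isomorphism class -/

open PTree WRTree

theorem TreeClass.totalWeight_tree {n : ℕ} (T : TreeClass n) : T.tree.totalWeight = n :=
  T.rep.2

theorem TreeClass.existsUnique_iso {n : ℕ} {P : PTree} (hP : P.weight = n) :
    ∃! T : TreeClass n, Nonempty (Iso P.toTree T.tree) := by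
  have := P.finite_vert
  obtain ⟨m, ⟨e⟩⟩ := Finite.exists_equiv_fin (Vert P)
  let t : TreeOfWeight n := ⟨⟨m, P.toTree.relabel e⟩, by
    rw [← (P.toTree.relabelIso e).weight_eq, hP]⟩
  have ht : Nonempty (Iso P.toTree t.tree) := ⟨P.toTree.relabelIso e⟩
  let T : TreeClass n := Quotient.mk (TreeOfWeight.isoSetoid n) t
  have hT : Nonempty (Iso T.tree t.tree) :=
    Quotient.exact (s := TreeOfWeight.isoSetoid n)
      (Quotient.out_eq (s := TreeOfWeight.isoSetoid n) T)
  refine ⟨T, ⟨ht.some.trans hT.some.symm⟩, fun T' hT' => ?_⟩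
  have h : Nonempty (Iso T'.tree t.tree) := ⟨hT'.some.symm.trans ht.some⟩
  exact (Quotient.out_eq (s := TreeOfWeight.isoSetoid n) T').symm.trans
    (Quotient.sound (s := TreeOfWeight.isoSetoid n) h)

/-- The sum over the isomorphism classes of trees, as a sum over plane trees. -/
theorem sum_treeClass {K : Type*} [CommRing K] [Algebra ℚ K] (s : K) (c : ℕ → ℕ → K) (n : ℕ) :
    ∑ T : TreeClass n, T.tree.treeFactor s • ∑ τ ∈ T.tree.tubings, T.tree.phi c τ =
      ∑ P ∈ ofWeight n, P.coef s • P.phi c := by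
  classical
  have h1 : ∀ P ∈ ofWeight n, P.coef s • P.phi c =
      ∑ T : TreeClass n, if Nonempty (Iso P.toTree T.tree) then P.coef s • P.phi c else 0 := by
    intro P hP
    obtain ⟨T, hT, hT'⟩ := TreeClass.existsUnique_iso (mem_ofWeight.1 hP)
    rw [Finset.sum_eq_single T (fun T' _ hne => if_neg fun h => hne (hT' T' h))
      (fun h => absurd (Finset.mem_univ _) h), if_pos hT]
  rw [Finset.sum_congr rfl h1, Finset.sum_comm]
  refine Finset.sum_congr rfl fun T _ => ?_
  rw [← Finset.sum_filter]
  have h2 : ∀ P : PTree, P ∈ (ofWeight n).filter (fun P => Nonempty (Iso P.toTree T.tree)) ↔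
      Nonempty (Iso P.toTree T.tree) := by
    intro P
    rw [Finset.mem_filter, mem_ofWeight]
    exact ⟨fun h => h.2, fun h => ⟨h.some.weight_eq.trans T.totalWeight_tree, h⟩⟩
  have h3 : Nat.card {P : PTree // Nonempty (Iso P.toTree T.tree)} =
      ((ofWeight n).filter (fun P => Nonempty (Iso P.toTree T.tree))).card := by
    rw [Nat.card_congr (Equiv.subtypeEquivRight fun P => (h2 P).symm), Nat.card_eq_fintype_card,
      Fintype.card_coe]
  -- Every plane embedding of T contributes the same share of the term of T.
  have h4 : ∀ P ∈ (ofWeight n).filter (fun P => Nonempty (Iso P.toTree T.tree)),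
      P.coef s • P.phi c = ((Nat.card {P : PTree // Nonempty (Iso P.toTree T.tree)} : ℚ)⁻¹ •
        T.tree.treeFactor s) • ∑ τ ∈ T.tree.tubings, T.tree.phi c τ := by
    intro P hP
    rw [h3]
    have hcard : (((ofWeight n).filter (fun P => Nonempty (Iso P.toTree T.tree))).card : ℚ) ≠ 0 :=
      Nat.cast_ne_zero.2 (Finset.card_ne_zero_of_mem hP)
    obtain ⟨e⟩ := (h2 P).1 hP
    rw [e.phi_eq, ← e.coef_eq, h3, smul_smul, inv_mul_cancel₀ hcard, one_smul]
  have h5 : (Nat.card {P : PTree // Nonempty (Iso P.toTree T.tree)} : ℚ) ≠ 0 := by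
    intro h0
    have := T.tree.card_plane_mul_card_aut
    rw [Nat.cast_eq_zero.1 h0, zero_mul] at this
    exact (Finset.prod_ne_zero_iff.2 fun u _ => Nat.factorial_ne_zero _) this.symm
  rw [Finset.sum_congr rfl h4, Finset.sum_const, ← h3, ← Nat.cast_smul_eq_nsmul ℚ, ← smul_assoc,
    smul_smul, mul_inv_cancel₀ h5, one_smul]

/-! ### Plane forests and the solution of the Dyson–Schwinger equation -/

namespace PTree

theorem finite_forest (r n : ℕ) : {f : Fin r → PTree | ∑ i, (f i).weight = n}.Finite := by
  refine (Set.Finite.pi' (ι := Fin r) (t := fun _ => {P : PTree | P.weight ≤ n})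
    fun _ => finite_weight_le n).subset fun f hf i => ?_
  change ∑ i, (f i).weight = n at hf
  exact hf ▸ Finset.single_le_sum (f := fun i => (f i).weight) (fun _ _ => Nat.zero_le _)
    (Finset.mem_univ i)

/-- The sequences of `r` plane trees with total weight `n`. -/
noncomputable def forests (r n : ℕ) : Finset (Fin r → PTree) := (finite_forest r n).toFinset

@[simp]
theorem mem_forests {r n : ℕ} {f : Fin r → PTree} :
    f ∈ forests r n ↔ ∑ i, (f i).weight = n := by
  simp [forests]

/-- A plane tree consists of the weight of the root and the sequence of its branches. -/
theorem sum_ofWeight {M : Type*} [AddCommMonoid M] (n : ℕ) (F : PTree → M) :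
    ∑ P ∈ ofWeight n, F P = ∑ k ∈ Finset.Icc 1 n, ∑ r ∈ Finset.range (n - k + 1),
      ∑ f ∈ forests r (n - k), F (node k.toPNat' r f) := by
  simp_rw [Finset.sum_sigma']
  symm
  refine Finset.sum_bij (fun x _ => node x.1.toPNat' x.2.1 x.2.2) ?_ ?_ ?_ fun _ _ => rfl
  · rintro ⟨k, r, f⟩ h
    simp only [Finset.mem_sigma, Finset.mem_Icc, Finset.mem_range, mem_forests] at h
    rw [mem_ofWeight, weight, h.2.2, Nat.toPNat'_coe, if_pos (Nat.lt_of_succ_le h.1.1)]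
    exact Nat.add_sub_cancel' h.1.2
  · rintro ⟨k, r, f⟩ h ⟨k', r', f'⟩ h' heq
    simp only [Finset.mem_sigma, Finset.mem_Icc] at h h'
    injection heq with e1 e2 e3
    have e5 : k = k' := by
      have := congrArg (fun k : ℕ+ => (k : ℕ)) e1
      simp only [Nat.toPNat'_coe] at this
      rwa [if_pos (Nat.lt_of_succ_le h.1.1), if_pos (Nat.lt_of_succ_le h'.1.1)] at this
    subst e5
    cases e2
    cases e3
    rfl
  · rintro ⟨k, r, f⟩ hP
    rw [mem_ofWeight, weight] at hP
    have := le_sum_weight f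
    have := k.pos
    refine ⟨⟨k, r, f⟩, ?_, ?_⟩
    · simp only [Finset.mem_sigma, Finset.mem_Icc, Finset.mem_range, mem_forests]
      omega
    · simp

end PTree

variable {K : Type*} [CommRing K] [Algebra ℚ K]

/-- The generating series of the plane trees. -/
noncomputable def planeSeries (s : K) (c : ℕ → ℕ → K) : PowerSeries K[X] :=
  PowerSeries.mk fun n => ∑ P ∈ ofWeight n, P.coef s • P.phi c

theorem coeff_planeSeries_pow (s : K) (c : ℕ → ℕ → K) (r n : ℕ) :
    PowerSeries.coeff n (planeSeries s c ^ r) =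
      ∑ f ∈ forests r n, (∏ i, (f i).coef s) • ∏ i, (f i).phi c := by
  classical
  have h : planeSeries s c ^ r = ∏ _i : Fin r, planeSeries s c := by
    rw [Finset.prod_const, Finset.card_univ, Fintype.card_fin]
  rw [h, PowerSeries.coeff_prod]
  simp only [planeSeries, PowerSeries.coeff_mk, Finset.prod_univ_sum]
  let L : (Fin r → PTree) → Fin r →₀ ℕ := fun f =>
    Finsupp.equivFunOnFinite.symm fun i => (f i).weight
  have hL : ∀ f ∈ forests r n, L f ∈ Finset.univ.finsuppAntidiag n := fun f hf => by
    rw [Finset.mem_finsuppAntidiag]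
    exact ⟨mem_forests.1 hf, Finset.subset_univ _⟩
  -- Forests are grouped by the vector of weights of their trees, which indexes the terms of the
  -- power.
  rw [← Finset.sum_fiberwise_of_maps_to hL]
  refine Finset.sum_congr rfl fun l hl => ?_
  refine Finset.sum_congr ?_ fun f _ => Finset.prod_smul _ _ _
  ext f
  simp only [Fintype.mem_piFinset, mem_ofWeight, Finset.mem_filter, mem_forests]
  rw [Finset.mem_finsuppAntidiag] at hl
  constructor
  · intro hf
    exact ⟨by rw [← hl.1]; exact Finset.sum_congr rfl fun i _ => hf i, Finsupp.ext hf⟩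
  · rintro ⟨-, rfl⟩ i
    rfl

theorem solvesDSE_iff (s : K) (c : ℕ → ℕ → K) (G : PowerSeries K[X]) :
    SolvesDSE s c G ↔ ∀ n, PowerSeries.coeff n G =
      PowerSeries.coeff n (1 : PowerSeries K[X]) + ∑ k ∈ Finset.Icc 1 n,
        insertionHom (fun i => c i k)
          (PowerSeries.coeff (n - k) (seriesPow G (1 + s * (k : K)))) := by
  refine forall_congr' fun n => ?_
  have : ∀ k ∈ Finset.Icc 1 n, PowerSeries.coeff n
      (PowerSeries.X ^ k * insertionSeries (fun i => c i k) (seriesPow G (1 + s * (k : K)))) =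
      insertionHom (fun i => c i k)
          (PowerSeries.coeff (n - k) (seriesPow G (1 + s * (k : K)))) := by
    intro k hk
    rw [PowerSeries.coeff_X_pow_mul', if_pos (Finset.mem_Icc.1 hk).2, insertionSeries,
      PowerSeries.coeff_mk]
    rfl
  rw [Finset.sum_congr rfl this]

theorem coeff_seriesPow_congr {G H : PowerSeries K[X]} {n : ℕ}
    (h : ∀ m ≤ n, PowerSeries.coeff m G = PowerSeries.coeff m H) (p : K) :
    PowerSeries.coeff n (seriesPow G p) = PowerSeries.coeff n (seriesPow H p) := by
  simp only [seriesPow, PowerSeries.coeff_mk]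
  refine Finset.sum_congr rfl fun r _ => ?_
  congr 1
  rw [PowerSeries.coeff_pow, PowerSeries.coeff_pow]
  refine Finset.sum_congr rfl fun l hl => Finset.prod_congr rfl fun i hi => ?_
  rw [map_sub, map_sub, h]
  rw [Finset.mem_finsuppAntidiag] at hl
  rw [← hl.1]
  exact Finset.single_le_sum (f := fun i => l i) (fun _ _ => Nat.zero_le _) hi

/-- Since k ≥ 1, coefficient n depends only on the coefficients up to n - k < n. -/
theorem SolvesDSE.unique {s : K} {c : ℕ → ℕ → K} {G H : PowerSeries K[X]}
    (hG : SolvesDSE s c G) (hH : SolvesDSE s c H) : G = H := by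
  rw [solvesDSE_iff] at hG hH
  ext1 n
  induction n using Nat.strong_induction_on with
  | _ n ih =>
  rw [hG, hH]
  congr 1
  refine Finset.sum_congr rfl fun k hk => ?_
  rw [Finset.mem_Icc] at hk
  rw [coeff_seriesPow_congr fun m hm => ih m (by omega)]

/-- Plane trees with root weight k and r branches produce the r-th binomial term of G^{1+sk}: the
root supplies x^k, the binomial coefficient and the insertion, and the branches supply (G - 1)^r. -/
theorem solvesDSE_planeSeries (s : K) (c : ℕ → ℕ → K) :
    SolvesDSE s c (1 + planeSeries s c) := by
  rw [solvesDSE_iff]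
  intro n
  rw [map_add]
  congr 1
  rw [planeSeries, PowerSeries.coeff_mk, sum_ofWeight, ← planeSeries]
  refine Finset.sum_congr rfl fun k hk => ?_
  rw [seriesPow, PowerSeries.coeff_mk, map_sum]
  refine Finset.sum_congr rfl fun r _ => ?_
  rw [add_sub_cancel_left, coeff_planeSeries_pow, map_smul, map_sum, Finset.smul_sum]
  refine Finset.sum_congr rfl fun f _ => ?_
  have hk' : ((k.toPNat' : ℕ+) : ℕ) = k := by
    have : 0 < k := (Finset.mem_Icc.1 hk).1
    rw [Nat.toPNat'_coe, if_pos this]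
  rw [map_smul, smul_smul, PTree.coef, PTree.phi, hk']

end TubingDSE

theorem mainTheorem1 {K : Type*} [CommRing K] [Algebra ℚ K] (s : K) (c : ℕ → ℕ → K) :
    (∀ G : PowerSeries (Polynomial K),
      TubingDSE.SolvesDSE s c G ↔
        G = 1 + PowerSeries.mk fun n =>
          ∑ T : TubingDSE.TreeClass n,
            T.tree.treeFactor s • ∑ τ ∈ T.tree.tubings, T.tree.phi c τ) ∧
    (∀ G : PowerSeries (Polynomial K),
      TubingDSE.SolvesDSE s c G →
        TubingDSE.anomalousDimension G = PowerSeries.mk fun n =>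
          ∑ T : TubingDSE.TreeClass n,
            T.tree.treeFactor s *
              ∑ τ ∈ T.tree.tubings, ∏ v, c (T.tree.bStat τ v - 1) (T.tree.weight v)) := by
  have key : ∀ G : PowerSeries (Polynomial K), TubingDSE.SolvesDSE s c G ↔
      G = 1 + PowerSeries.mk fun n =>
        ∑ T : TubingDSE.TreeClass n,
          T.tree.treeFactor s • ∑ τ ∈ T.tree.tubings, T.tree.phi c τ := by
    intro G
    simp only [TubingDSE.sum_treeClass]
    have h := TubingDSE.solvesDSE_planeSeries s c
    exact ⟨fun hG => hG.unique h, fun hG => hG ▸ h⟩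
  refine ⟨key, fun G hG => ?_⟩
  rw [(key G).1 hG]
  ext n
  rw [TubingDSE.anomalousDimension, PowerSeries.coeff_mk, PowerSeries.coeff_mk, map_add,
    PowerSeries.coeff_mk, Polynomial.coeff_add, Polynomial.finsetSum_coeff]
  have h0 : (PowerSeries.coeff n (1 : PowerSeries (Polynomial K))).coeff 1 = 0 := by
    rw [PowerSeries.coeff_one]
    split_ifs <;> simp [Polynomial.coeff_one]
  rw [h0, zero_add]
  refine Finset.sum_congr rfl fun T _ => ?_
  rw [Polynomial.coeff_smul, TubingDSE.WRTree.coeff_one_sum_phi, smul_eq_mul]
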